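/- For $1\le m\le n$ let $V_{n,m}=\{v\in\mathbb R^{n\times m}: v^{T}v=I_m\}$ be the Stiefel manifold, with its $O(n)$-invariant probability measure $d_*v$. For a square matrix $a$ write $|a|=|\det a|$. For $u\in V_{n,k}$ with $m+k\le n$, let $d_uv$ be the invariant probability measure on $\{v\in V_{n,m}: u^{T}v=0\}$, i.e. the image of $d_*\omega$ on $V_{n-k,m}$ under $\omega\mapsto\tilde u\,\omega$, where $\tilde u\in V_{n,n-k}$ is any orthonormal frame of the orthogonal complement of the column space of $u$. Define, for functions $f$ on $V_{n,m}$ and $\varphi$ on $V_{n,k}$, the Funk transform and its dual $$(F_{m,k}f)(u)=\int_{u^{T}v=0} f(v)\,d_uv,\qquad (F^*_{m,k}\varphi)(v)=\int_{v^{T}u=0}\varphi(u)\,d_vu,\qquad F_m=F_{m,m},$$ the cosine transform and its dual $$(C^{\alpha}_{m,k}f)(u)=\int_{V_{n,m}} f(v)\,|v^{T}uu^{T}v|^{(\alpha-k)/2}\,d_*v,\qquad (C^{*\alpha}_{m,k}\varphi)(v)=\int_{V_{n,k}}\varphi(u)\,|v^{T}uu^{T}v|^{(\alpha-k)/2}\,d_*u,$$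 and, for $u\in V_{n,m}$, $$(M^{\alpha}f)(u)=\int_{V_{n,m}} f(v)\,|v^{T}uu^{T}v|^{(\alpha-m)/2}\,d_*v,\qquad (Q^{\alpha}f)(u)=\int_{V_{n,m}} f(v)\,|I_m-v^{T}uu^{T}v|^{(\alpha+m-n)/2}\,d_*v .$$ Let $\Gamma_m(\alpha)=\pi^{m(m-1)/4}\prod_{j=0}^{m-1}\Gamma(\alpha-j/2)$ be the Siegel gamma function. **Theorem.** Let $f\in L^1(V_{n,m})$ (complex-valued), $1\le m\le k\le n-m$ and $\alpha\in\mathbb C$. (i) If $\operatorname{Re}\alpha>m-1$, then almost everywhere on $V_{n,m}$ $$C^{*\alpha}_{m,k}F_{m,k}f=F^*_{m,k}C^{\alpha}_{m,k}f=c_\alpha\,Q^{\alpha+n-k-m}f,\qquad c_\alpha=\frac{\Gamma_m((n-m)/2)\,\Gamma_m(\alpha/2)}{\Gamma_m(k/2)\,\Gamma_m((\alpha+n-m-k)/2)} .$$ (ii) If $\operatorname{Re}\alpha>k-1$, then almost everywhere on $V_{n,m}$ $$C^{*\alpha}_{m,k}F_{m,k}f=F^*_{m,k}C^{\alpha}_{m,k}f=\tilde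 c_\alpha\,M^{\alpha+m-k}F_{m}f,\qquad \tilde c_\alpha=\frac{\Gamma_m(m/2)\,\Gamma_m(\alpha/2)}{\Gamma_m(k/2)\,\Gamma_m((\alpha+m-k)/2)} .$$ Here all the integrals involved converge absolutely almost everywhere, and the intermediate functions $F_{m,k}f$, $C^{\alpha}_{m,k}f$ (on $V_{n,k}$) and, in (ii), $F_mf$ (on $V_{n,m}$) are integrable. -/

import Mathlib

open MeasureTheory

namespace StiefelTransforms

/-- Matrices carry the (entrywise) Borel `σ`-algebra. -/
instance matrixMeasurableSpace (n m : ℕ) : MeasurableSpace (Matrix (Fin n) (Fin m) ℝ) :=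
  inferInstanceAs (MeasurableSpace (Fin n → Fin m → ℝ))

instance matrixBorelSpace (n m : ℕ) : BorelSpace (Matrix (Fin n) (Fin m) ℝ) :=
  inferInstanceAs (BorelSpace (Fin n → Fin m → ℝ))

/-- The Stiefel manifold `V_{n,m}` of real `n × m` matrices `v` with `vᵀ v = I_m`
(orthonormal `m`-frames in `ℝⁿ`), as a subspace of the space of matrices. -/
abbrev Stiefel (n m : ℕ) : Type :=
  {v : Matrix (Fin n) (Fin m) ℝ // v.transpose * v = 1}

theorem orthogonal_transpose_mul {n : ℕ} (g : Matrix.orthogonalGroup (Fin n) ℝ) :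
    (g : Matrix (Fin n) (Fin n) ℝ).transpose * (g : Matrix (Fin n) (Fin n) ℝ) = 1 :=
  (Matrix.mem_orthogonalGroup_iff' (Fin n) ℝ).1 g.2

theorem abs_entry_le_one {n m : ℕ} {v : Matrix (Fin n) (Fin m) ℝ}
    (hv : v.transpose * v = 1) (i : Fin n) (j : Fin m) : |v i j| ≤ 1 := by
  have h : ∑ l, v l j * v l j = 1 := by
    have := congrFun (congrFun hv j) j
    simpa [Matrix.mul_apply] using this
  have h2 : v i j * v i j ≤ 1 := by
    rw [← h]
    exact Finset.single_le_sum (f := fun l => v l j * v l j)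
      (fun l _ => mul_self_nonneg _) (Finset.mem_univ i)
  exact abs_le_one_iff_mul_self_le_one.2 h2

instance orthogonalGroup_compactSpace (n : ℕ) :
    CompactSpace (Matrix.orthogonalGroup (Fin n) ℝ) := by
  suffices hK : IsCompact (Matrix.orthogonalGroup (Fin n) ℝ : Set (Matrix (Fin n) (Fin n) ℝ)) from
    isCompact_iff_compactSpace.1 hK
  have hbox : IsCompact (Set.univ.pi fun _ : Fin n => Set.univ.pi fun _ : Fin n =>
      Set.Icc (-1 : ℝ) 1) :=
    isCompact_univ_pi fun _ => isCompact_univ_pi fun _ => isCompact_Icc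
  refine IsCompact.of_isClosed_subset (X := Fin n → Fin n → ℝ) hbox ?_ ?_
  · have hset : ((Matrix.orthogonalGroup (Fin n) ℝ : Set (Matrix (Fin n) (Fin n) ℝ))) =
        {g : Matrix (Fin n) (Fin n) ℝ | g.transpose * g = 1} := by
      ext g
      exact Matrix.mem_orthogonalGroup_iff' (Fin n) ℝ
    have hcl : IsClosed {g : Matrix (Fin n) (Fin n) ℝ | g.transpose * g = 1} :=
      isClosed_eq (by fun_prop) continuous_const
    rw [← hset] at hcl
    exact hcl
  · intro g hg i _ j _
    exact abs_le.1 (abs_entry_le_one ((Matrix.mem_orthogonalGroup_iff' (Fin n) ℝ).1 hg) i j)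

/-- The first `m` columns of an orthogonal matrix `g`, that is, `g` applied to the
`m`-frame `[I_m; 0]`. -/
def leadingFrame {n m : ℕ} (h : m ≤ n) (g : Matrix.orthogonalGroup (Fin n) ℝ) :
    Stiefel n m :=
  ⟨(g : Matrix (Fin n) (Fin n) ℝ).submatrix id (Fin.castLE h), by
    have hg := orthogonal_transpose_mul g
    ext i j
    have := congrFun (congrFun hg (Fin.castLE h i)) (Fin.castLE h j)
    simpa [Matrix.mul_apply, Matrix.one_apply] using this⟩

/-- The `O(n)`-invariant probability measure `d_* v` on `V_{n,m} = O(n) / O(n-m)`, `m ≤ n`: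
the image of the normalized Haar measure of `O(n)`. (For `m > n` the space is empty.) -/
noncomputable def stiefelMeasure (n m : ℕ) : Measure (Stiefel n m) :=
  if h : m ≤ n then
    (Measure.haarMeasure
      (⊤ : TopologicalSpace.PositiveCompacts (Matrix.orthogonalGroup (Fin n) ℝ))).map
        (leadingFrame h)
  else 0

/-- The product `w ω ∈ V_{n,m}` of `w ∈ V_{n,p}` and `ω ∈ V_{p,m}`. -/
def frameMul {n p m : ℕ} (w : Stiefel n p) (ω : Stiefel p m) : Stiefel n m :=
  ⟨w.1 * ω.1, by
    rw [Matrix.transpose_mul, Matrix.mul_assoc, ← Matrix.mul_assoc _ w.1 ω.1, w.2,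
      Matrix.one_mul, ω.2]⟩

theorem exists_complementary_frame {n k : ℕ} (u : Stiefel n k) :
    ∃ w : Stiefel n (n - k), u.1.transpose * w.1 = 0 := by
  classical
  let c : Fin k → EuclideanSpace ℝ (Fin n) := fun j => WithLp.toLp 2 fun i => u.1 i j
  have hinner : ∀ x y : EuclideanSpace ℝ (Fin n), inner ℝ x y = ∑ i, x i * y i := by
    intro x y
    simp [PiLp.inner_apply, mul_comm]
  have hc : Orthonormal ℝ c := by
    rw [orthonormal_iff_ite]
    intro i j
    have := congrFun (congrFun u.2 i) j
    simp only [Matrix.mul_apply, Matrix.transpose_apply, Matrix.one_apply] at this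
    rw [hinner]
    exact this
  let S : Submodule ℝ (EuclideanSpace ℝ (Fin n)) := Submodule.span ℝ (Set.range c)
  have hS : Module.finrank ℝ S = k := by
    simpa using finrank_span_eq_card hc.linearIndependent
  have hperp : Module.finrank ℝ Sᗮ = n - k := by
    have := S.finrank_add_finrank_orthogonal
    rw [hS, finrank_euclideanSpace_fin] at this
    omega
  let b : OrthonormalBasis (Fin (n - k)) ℝ Sᗮ :=
    (stdOrthonormalBasis ℝ Sᗮ).reindex (finCongr hperp)
  refine ⟨⟨Matrix.of fun i j => (b j : EuclideanSpace ℝ (Fin n)) i, ?_⟩, ?_⟩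
  · ext i j
    have := orthonormal_iff_ite.1 b.orthonormal i j
    rw [Submodule.coe_inner, hinner] at this
    simpa [Matrix.mul_apply, Matrix.one_apply] using this
  · ext i j
    have := Submodule.inner_right_of_mem_orthogonal
      (Submodule.subset_span (Set.mem_range_self i) : c i ∈ S) (b j).2
    rw [hinner] at this
    simpa [Matrix.mul_apply] using this

/-- An orthonormal frame of the orthogonal complement of the column space of `u`: the first
`n - k` columns of an orthogonal matrix whose last `k` columns form `u`. -/
noncomputable def complementaryFrame {n k : ℕ} (u : Stiefel n k) : Stiefel n (n - k) :=
  Classical.choose (exists_complementary_frame u)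

/-- The invariant probability measure `d_u v` on `{v ∈ V_{n,m} : uᵀ v = 0}`, `m ≤ n - k`,
regarded as a measure on `V_{n,m}`: the image of `d_* ω` on `V_{n-k,m}` under `ω ↦ ũ ω`,
where `ũ` is an orthonormal frame of the orthogonal complement of `u`.
It does not depend on the choice of `ũ`, because `d_* ω` is left `O(n-k)`-invariant. -/
noncomputable def fiberMeasure {n k : ℕ} (m : ℕ) (u : Stiefel n k) : Measure (Stiefel n m) :=
  (stiefelMeasure (n - k) m).map (frameMul (complementaryFrame u))

/-- The higher-rank Funk transform `(F_{m,k} f)(u) = ∫_{uᵀ v = 0} f(v) d_u v`. -/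
noncomputable def funk {n m k : ℕ} (f : Stiefel n m → ℂ) (u : Stiefel n k) : ℂ :=
  ∫ v, f v ∂(fiberMeasure m u)

/-- The dual Funk transform `(F*_{m,k} φ)(v) = ∫_{vᵀ u = 0} φ(u) d_v u`. -/
noncomputable def dualFunk {n m k : ℕ} (φ : Stiefel n k → ℂ) (v : Stiefel n m) : ℂ :=
  ∫ u, φ u ∂(fiberMeasure k v)

/-- `|vᵀ u uᵀ v|^s`, where `|a|` is the absolute value of the determinant of `a`. -/
noncomputable def cosKernel {n m k : ℕ} (s : ℂ) (v : Stiefel n m) (u : Stiefel n k) : ℂ :=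
  ((|(v.1.transpose * u.1 * u.1.transpose * v.1).det| : ℝ) : ℂ) ^ s

/-- `|I_m - vᵀ u uᵀ v|^s`, where `|a|` is the absolute value of the determinant of `a`. -/
noncomputable def sinKernel {n m k : ℕ} (s : ℂ) (v : Stiefel n m) (u : Stiefel n k) : ℂ :=
  ((|(1 - v.1.transpose * u.1 * u.1.transpose * v.1).det| : ℝ) : ℂ) ^ s

/-- The cosine transform
`(C^α_{m,k} f)(u) = ∫_{V_{n,m}} f(v) |vᵀ u uᵀ v|^{(α-k)/2} d_* v`. -/
noncomputable def cosineTransform {n m k : ℕ} (α : ℂ) (f : Stiefel n m → ℂ)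
    (u : Stiefel n k) : ℂ :=
  ∫ v, f v * cosKernel ((α - k) / 2) v u ∂(stiefelMeasure n m)

/-- The dual cosine transform
`(C*^α_{m,k} φ)(v) = ∫_{V_{n,k}} φ(u) |vᵀ u uᵀ v|^{(α-k)/2} d_* u`. -/
noncomputable def dualCosineTransform {n m k : ℕ} (α : ℂ) (φ : Stiefel n k → ℂ)
    (v : Stiefel n m) : ℂ :=
  ∫ u, φ u * cosKernel ((α - k) / 2) v u ∂(stiefelMeasure n k)

/-- `(M^α f)(u) = ∫_{V_{n,m}} f(v) |vᵀ u uᵀ v|^{(α-m)/2} d_* v`, `u ∈ V_{n,m}`. -/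
noncomputable def cosineM {n m : ℕ} (α : ℂ) (f : Stiefel n m → ℂ) (u : Stiefel n m) : ℂ :=
  ∫ v, f v * cosKernel ((α - m) / 2) v u ∂(stiefelMeasure n m)

/-- `(Q^α f)(u) = ∫_{V_{n,m}} f(v) |I_m - vᵀ u uᵀ v|^{(α+m-n)/2} d_* v`, `u ∈ V_{n,m}`. -/
noncomputable def sineQ {n m : ℕ} (α : ℂ) (f : Stiefel n m → ℂ) (u : Stiefel n m) : ℂ :=
  ∫ v, f v * sinKernel ((α + m - n) / 2) v u ∂(stiefelMeasure n m)

/-- The Siegel gamma function `Γ_m(α) = π^{m(m-1)/4} ∏_{j=0}^{m-1} Γ(α - j/2)`. -/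
noncomputable def siegelGamma (m : ℕ) (α : ℂ) : ℂ :=
  ((Real.pi ^ ((m : ℝ) * ((m : ℝ) - 1) / 4) : ℝ) : ℂ) *
    ∏ j ∈ Finset.range m, Complex.Gamma (α - (j : ℂ) / 2)

end StiefelTransforms

namespace StiefelTransforms

open Matrix ProbabilityTheory Set

/-! All transforms commute with O(n), and every kernel is a power |AᵀA|^s of a Gram determinant:
|vᵀuuᵀv| comes from A = uᵀv, and |I - vᵀuuᵀv| from A = wᵀv with w a frame complementary to u.
Everything rests on one formula, ∫ |Aᵀuuᵀ A|^s d_*u = c |AᵀA|^s over V_{n,k}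
(`integral_gramPow_transpose_mul`). Proportionality follows from invariance, once the integral
converges for one frame; convergence and the value of c come by induction on the number of columns
of A, the last column being averaged against a Gaussian.

The k-frames orthogonal to w are w̃ω with ω in V_{n-m,k}. The formula in dimension n - m with A =
w̃ᵀv shows that the cosine kernel averaged over them is a multiple of the sine kernel
(`integral_cosKernel_fiberMeasure`). Part (i) is then Fubini: for F*C an interchange of integrals,
for C*F the symmetry of the law of a random orthogonal pair (`map_swap_compProd_fiberKernel`). For
part (ii), the case k = m with the same exponent expresses the same sine integral through the cosine
transform of F_m f, and the constants telescope. -/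

/-! ### The action of O(n) on frames and its transitivity. -/

/-- An orthogonal matrix, regarded as an orthonormal `n`-frame. -/
def orthFrame {n : ℕ} (g : orthogonalGroup (Fin n) ℝ) : Stiefel n n :=
  ⟨g.1, orthogonal_transpose_mul g⟩

/-- The action of `O(n)` on `V_{n,m}` by left multiplication. -/
def act {n m : ℕ} (g : orthogonalGroup (Fin n) ℝ) (v : Stiefel n m) : Stiefel n m :=
  frameMul (orthFrame g) v

theorem act_val {n m : ℕ} (g : orthogonalGroup (Fin n) ℝ) (v : Stiefel n m) :
    (act g v).1 = g.1 * v.1 := rfl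

theorem mul_act {n m : ℕ} (g h : orthogonalGroup (Fin n) ℝ) (v : Stiefel n m) :
    act (g * h) v = act g (act h v) :=
  Subtype.ext (Matrix.mul_assoc _ _ _)

theorem act_frameMul {n p m : ℕ} (g : orthogonalGroup (Fin n) ℝ) (w : Stiefel n p)
    (v : Stiefel p m) : act g (frameMul w v) = frameMul (act g w) v :=
  Subtype.ext (Matrix.mul_assoc _ _ _).symm

theorem leadingFrame_eq_act {n m : ℕ} (h : m ≤ n) (g : orthogonalGroup (Fin n) ℝ) :
    leadingFrame h g = act g (leadingFrame h 1) := by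
  apply Subtype.ext
  rw [act_val]
  ext i j
  simp [leadingFrame, Matrix.mul_apply, Matrix.one_apply]

/-- An orthonormal frame together with a complementary one is an orthonormal basis. -/
theorem mul_transpose_add_mul_transpose {n m : ℕ} (h : m ≤ n) (u : Stiefel n m)
    (w : Stiefel n (n - m)) (huw : u.1ᵀ * w.1 = 0) :
    u.1 * u.1ᵀ + w.1 * w.1ᵀ = 1 := by
  have hwu : w.1ᵀ * u.1 = 0 := by
    rw [← Matrix.transpose_transpose (w.1ᵀ * u.1), Matrix.transpose_mul,
      Matrix.transpose_transpose, huw, Matrix.transpose_zero]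
  -- Up to this reindexing [u w] is square, so its left inverse [u w]ᵀ is also a right inverse.
  have e : Fin m ⊕ Fin (n - m) ≃ Fin n := finSumFinEquiv.trans (finCongr (by omega))
  rw [← Matrix.fromCols_mul_fromRows, Matrix.mul_eq_one_comm_of_equiv e.symm,
    Matrix.fromRows_mul_fromCols, u.2, w.2, huw, hwu, Matrix.fromBlocks_one]

/-- Completing to orthonormal bases [u x] and [v y], the matrix v uᵀ + y xᵀ carries the first basis
to the second. -/
theorem exists_act_eq {n m : ℕ} (h : m ≤ n) (u v : Stiefel n m) :
    ∃ g : orthogonalGroup (Fin n) ℝ, act g u = v := by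
  obtain ⟨x, hx⟩ := exists_complementary_frame u
  obtain ⟨y, hy⟩ := exists_complementary_frame v
  have hxu : x.1ᵀ * u.1 = 0 := by
    rw [← Matrix.transpose_transpose (x.1ᵀ * u.1), Matrix.transpose_mul,
      Matrix.transpose_transpose, hx, Matrix.transpose_zero]
  refine ⟨⟨v.1 * u.1ᵀ + y.1 * x.1ᵀ, (mem_orthogonalGroup_iff (Fin n) ℝ).2 ?_⟩, ?_⟩
  · rw [transpose_add, transpose_mul, transpose_mul, transpose_transpose, transpose_transpose,
      Matrix.add_mul, Matrix.mul_add, Matrix.mul_add]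
    have h1 : v.1 * u.1ᵀ * (u.1 * v.1ᵀ) = v.1 * v.1ᵀ := by
      rw [Matrix.mul_assoc, ← Matrix.mul_assoc u.1ᵀ, u.2, Matrix.one_mul]
    have h2 : v.1 * u.1ᵀ * (x.1 * y.1ᵀ) = 0 := by
      rw [Matrix.mul_assoc, ← Matrix.mul_assoc u.1ᵀ, hx, Matrix.zero_mul, Matrix.mul_zero]
    have h3 : y.1 * x.1ᵀ * (u.1 * v.1ᵀ) = 0 := by
      rw [Matrix.mul_assoc, ← Matrix.mul_assoc x.1ᵀ, hxu, Matrix.zero_mul, Matrix.mul_zero]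
    have h4 : y.1 * x.1ᵀ * (x.1 * y.1ᵀ) = y.1 * y.1ᵀ := by
      rw [Matrix.mul_assoc, ← Matrix.mul_assoc x.1ᵀ, x.2, Matrix.one_mul]
    rw [h1, h2, h3, h4, add_zero, zero_add, mul_transpose_add_mul_transpose h v y hy]
  · apply Subtype.ext
    rw [act_val]
    change (v.1 * u.1ᵀ + y.1 * x.1ᵀ) * u.1 = v.1
    rw [Matrix.add_mul, Matrix.mul_assoc, Matrix.mul_assoc, u.2, hxu, Matrix.mul_one,
      Matrix.mul_zero, add_zero]

/-- `O(n)` acts transitively on pairs of mutually orthogonal frames. -/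
theorem exists_act_eq_and_act_eq {n k m : ℕ} (h : k + m ≤ n) {a a' : Stiefel n k}
    {b b' : Stiefel n m} (hab : a.1ᵀ * b.1 = 0) (hab' : a'.1ᵀ * b'.1 = 0) :
    ∃ g : orthogonalGroup (Fin n) ℝ, act g a = a' ∧ act g b = b' := by
  -- Two mutually orthogonal frames side by side form a single (k+m)-frame, so transitivity on
  -- frames suffices.
  have hframe : ∀ (x : Stiefel n k) (y : Stiefel n m), x.1ᵀ * y.1 = 0 →
      ((fromCols x.1 y.1).submatrix id (finSumFinEquiv (m := k) (n := m)).symm)ᵀ *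
        ((fromCols x.1 y.1).submatrix id (finSumFinEquiv (m := k) (n := m)).symm) = 1 := by
    intro x y hxy
    have hyx : y.1ᵀ * x.1 = 0 := by
      rw [← Matrix.transpose_transpose (y.1ᵀ * x.1), Matrix.transpose_mul,
        Matrix.transpose_transpose, hxy, Matrix.transpose_zero]
    rw [transpose_submatrix, ← submatrix_mul _ _ _ id _ Function.bijective_id,
      transpose_fromCols, fromRows_mul_fromCols, x.2, y.2, hxy, hyx, fromBlocks_one,
      submatrix_one_equiv]
  obtain ⟨g, hg⟩ := exists_act_eq h ⟨_, hframe a b hab⟩ ⟨_, hframe a' b' hab'⟩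
  have hg' := congrArg Subtype.val hg
  rw [act_val] at hg'
  have key : g.1 * fromCols a.1 b.1 = fromCols a'.1 b'.1 := by
    ext i j
    have := congrFun (congrFun hg' i) (finSumFinEquiv j)
    simpa [Matrix.mul_apply] using this
  rw [mul_fromCols, ← act_val, ← act_val] at key
  refine ⟨g, Subtype.ext ?_, Subtype.ext ?_⟩
  · ext i j
    simpa using congrFun (congrFun key i) (Sum.inl j)
  · ext i j
    simpa using congrFun (congrFun key i) (Sum.inr j)

/-! ### QR factorization and powers of Gram determinants. -/

/-- A matrix with at least as many rows as columns is an orthonormal frame times a square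
matrix. -/
theorem exists_frame_mul_eq {p m : ℕ} (h : m ≤ p) (A : Matrix (Fin p) (Fin m) ℝ) :
    ∃ (θ : Stiefel p m) (B : Matrix (Fin m) (Fin m) ℝ), A = θ.1 * B := by
  classical
  -- The columns of A are padded with zeros to p vectors, so that Gram–Schmidt yields a full
  -- orthonormal basis; by triangularity only its first m vectors enter the columns of A.
  let f : Fin p → EuclideanSpace ℝ (Fin p) := fun i =>
    if hi : (i : ℕ) < m then WithLp.toLp 2 (fun l => A l ⟨i, hi⟩) else 0
  let b := InnerProductSpace.gramSchmidtOrthonormalBasis (𝕜 := ℝ) finrank_euclideanSpace f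
  have hinner : ∀ x y : EuclideanSpace ℝ (Fin p), inner ℝ x y = ∑ i, x i * y i := by
    intro x y
    simp [PiLp.inner_apply, mul_comm]
  have hf : ∀ (i : Fin m) (l : Fin p), f (Fin.castLE h i) l = A l i := by
    intro i l
    simp [f]
  refine ⟨⟨Matrix.of fun l j => b (Fin.castLE h j) l, ?_⟩,
    Matrix.of fun j i => inner ℝ (b (Fin.castLE h j)) (f (Fin.castLE h i)), ?_⟩
  · ext i j
    have := orthonormal_iff_ite.1 b.orthonormal (Fin.castLE h i) (Fin.castLE h j)
    rw [hinner] at this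
    simpa [Matrix.mul_apply, Matrix.one_apply] using this
  · ext l i
    have h1 := congrArg (fun x : EuclideanSpace ℝ (Fin p) => x l)
      (b.sum_repr' (f (Fin.castLE h i)))
    simp only [WithLp.ofLp_sum, WithLp.ofLp_smul, Finset.sum_apply, Pi.smul_apply,
      smul_eq_mul, hf] at h1
    rw [← h1, Matrix.mul_apply]
    symm
    refine Finset.sum_of_injOn (Fin.castLE h) (Fin.castLE_injective h).injOn
      (by simp) (fun j _ hj => ?_) (fun j _ => ?_)
    · have hjm : m ≤ (j : ℕ) := by
        by_contra! hlt
        exact hj ⟨⟨j, hlt⟩, by simp, by ext; simp⟩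
      have : inner ℝ (b j) (f (Fin.castLE h i)) = 0 :=
        InnerProductSpace.gramSchmidtOrthonormalBasis_inv_triangular _ f
          (by rw [Fin.lt_def]; simp; omega)
      rw [this, zero_mul]
    · simp [mul_comm]

/-- The power `|AᵀA|^s` of the Gram determinant of the columns of `A`. -/
noncomputable def gramPow (s : ℂ) {p m : ℕ} (A : Matrix (Fin p) (Fin m) ℝ) : ℂ :=
  ((|(Aᵀ * A).det| : ℝ) : ℂ) ^ s

theorem cosKernel_eq_gramPow {n m k : ℕ} (s : ℂ) (v : Stiefel n m) (u : Stiefel n k) :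
    cosKernel s v u = gramPow s (u.1ᵀ * v.1) := by
  rw [cosKernel, gramPow, transpose_mul, transpose_transpose, Matrix.mul_assoc (_ * _)]

/-- Since w wᵀ = 1 - u uᵀ, the matrix I - vᵀuuᵀv equals (wᵀv)ᵀ(wᵀv). -/
theorem sinKernel_eq_gramPow {n m k : ℕ} (h : k ≤ n) (s : ℂ) (v : Stiefel n m) (u : Stiefel n k)
    (w : Stiefel n (n - k)) (huw : u.1ᵀ * w.1 = 0) :
    sinKernel s v u = gramPow s (w.1ᵀ * v.1) := by
  rw [sinKernel, gramPow, transpose_mul, transpose_transpose]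
  have h1 : v.1ᵀ * w.1 * (w.1ᵀ * v.1) = 1 - v.1ᵀ * u.1 * u.1ᵀ * v.1 := by
    have := mul_transpose_add_mul_transpose h u w huw
    rw [Matrix.mul_assoc, ← Matrix.mul_assoc w.1, eq_sub_of_add_eq' this, Matrix.sub_mul,
      Matrix.one_mul, Matrix.mul_sub, v.2]
    simp only [Matrix.mul_assoc]
  rw [h1]

/-- Sylvester's identity det(1 - XY) = det(1 - YX) with X = vᵀu, Y = uᵀv. -/
theorem sinKernel_comm {n m k : ℕ} (s : ℂ) (v : Stiefel n m) (u : Stiefel n k) :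
    sinKernel s v u = sinKernel s u v := by
  rw [sinKernel, sinKernel, Matrix.mul_assoc (_ * _), Matrix.mul_assoc (_ * _),
    det_one_sub_mul_comm]

theorem cosKernel_comm {n m : ℕ} (s : ℂ) (v u : Stiefel n m) :
    cosKernel s v u = cosKernel s u v := by
  have h : ∀ v u : Stiefel n m, (v.1ᵀ * u.1 * u.1ᵀ * v.1).det = (v.1ᵀ * u.1).det *
      (u.1ᵀ * v.1).det := fun v u => by rw [Matrix.mul_assoc (_ * _), det_mul]
  rw [cosKernel, cosKernel, h, h, mul_comm]

/-- Complex powers are multiplicative here because both bases are nonnegative reals. With the QR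
factorization this reduces questions about arbitrary A to frames. -/
theorem gramPow_mul (s : ℂ) {p m : ℕ} (A : Matrix (Fin p) (Fin m) ℝ)
    (B : Matrix (Fin m) (Fin m) ℝ) : gramPow s (A * B) = gramPow s A * gramPow s B := by
  have : ((A * B)ᵀ * (A * B)).det = (Aᵀ * A).det * (Bᵀ * B).det := by
    rw [transpose_mul, ← Matrix.mul_assoc, Matrix.mul_assoc Bᵀ, det_mul, det_mul, det_mul]
    ring
  rw [gramPow, this, abs_mul, Complex.ofReal_mul,
    Complex.mul_cpow_ofReal_nonneg (abs_nonneg _) (abs_nonneg _)]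
  rfl

theorem gramPow_frame (s : ℂ) {n m : ℕ} (v : Stiefel n m) : gramPow s v.1 = 1 := by
  simp [gramPow, v.2]

theorem gramPow_of_isEmpty (s : ℂ) {p : ℕ} (A : Matrix (Fin p) (Fin 0) ℝ) : gramPow s A = 1 := by
  simp [gramPow]

theorem measurable_gramPow (s : ℂ) {p m : ℕ} :
    Measurable (gramPow s : Matrix (Fin p) (Fin m) ℝ → ℂ) := by
  unfold gramPow
  have : Measurable fun A : Matrix (Fin p) (Fin m) ℝ => (Aᵀ * A).det :=
    Continuous.measurable (by fun_prop)
  have h2 : Measurable fun x : ℝ => ((|x| : ℝ) : ℂ) :=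
    (Complex.continuous_ofReal.comp continuous_abs).measurable
  exact (h2.comp this).pow_const s

/-- The matrix `A` with the additional last column `g`. -/
def snocCol {p m : ℕ} (A : Matrix (Fin p) (Fin m) ℝ) (g : Fin p → ℝ) :
    Matrix (Fin p) (Fin (m + 1)) ℝ :=
  (fromCols A (replicateCol (Fin 1) g)).submatrix id finSumFinEquiv.symm

theorem mul_snocCol {q p m : ℕ} (M : Matrix (Fin q) (Fin p) ℝ) (A : Matrix (Fin p) (Fin m) ℝ)
    (g : Fin p → ℝ) : M * snocCol A g = snocCol (M * A) (M *ᵥ g) := by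
  have : fromCols (M * A) (replicateCol (Fin 1) (M *ᵥ g)) =
      M * fromCols A (replicateCol (Fin 1) g) := by
    rw [mul_fromCols, replicateCol_mulVec]
  rw [snocCol, snocCol, this, submatrix_mul _ _ _ id _ Function.bijective_id, submatrix_id_id]

/-- Appending g multiplies the Gram determinant by the squared distance |wᵀg|² from g to the span of
θ. In matrices: [θB g] = [θ g] diag(B, 1), followed by a Schur complement. -/
theorem gramPow_snocCol_frame_mul (s : ℂ) {p m : ℕ} (h : m ≤ p) (θ : Stiefel p m)
    (w : Stiefel p (p - m)) (hw : θ.1ᵀ * w.1 = 0) (B : Matrix (Fin m) (Fin m) ℝ)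
    (g : Fin p → ℝ) :
    gramPow s (snocCol (θ.1 * B) g) =
      gramPow s B * (((w.1ᵀ *ᵥ g) ⬝ᵥ (w.1ᵀ *ᵥ g) : ℝ) : ℂ) ^ s := by
  set c := replicateCol (Fin 1) g
  have h1 : fromCols (θ.1 * B) c = fromCols θ.1 c *
      (fromBlocks B 0 0 1 : Matrix (Fin m ⊕ Fin 1) (Fin m ⊕ Fin 1) ℝ) := by
    rw [fromCols_mul_fromBlocks]
    simp
  have h2 : cᵀ * c - cᵀ * θ.1 * (θ.1ᵀ * c) = (w.1ᵀ * c)ᵀ * (w.1ᵀ * c) := by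
    have := mul_transpose_add_mul_transpose h θ w hw
    rw [transpose_mul, transpose_transpose, Matrix.mul_assoc, ← Matrix.mul_assoc θ.1,
      eq_sub_of_add_eq this, Matrix.sub_mul, Matrix.mul_sub, Matrix.one_mul, sub_sub_cancel]
    simp only [Matrix.mul_assoc]
  have h3 : ((snocCol (θ.1 * B) g)ᵀ * snocCol (θ.1 * B) g).det =
      (Bᵀ * B).det * ((w.1ᵀ *ᵥ g) ⬝ᵥ (w.1ᵀ *ᵥ g)) := by
    rw [snocCol, transpose_submatrix, ← submatrix_mul _ _ _ id _ Function.bijective_id,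
      det_submatrix_equiv_self, h1, transpose_mul, Matrix.mul_assoc,
      ← Matrix.mul_assoc (fromCols θ.1 c)ᵀ, det_mul, det_mul, transpose_fromCols,
      fromRows_mul_fromCols, θ.2, det_fromBlocks_one₁₁, det_transpose, det_fromBlocks_zero₂₁,
      det_one, mul_one, h2, det_mul, det_transpose]
    have : ((w.1ᵀ * c)ᵀ * (w.1ᵀ * c)).det = (w.1ᵀ *ᵥ g) ⬝ᵥ (w.1ᵀ *ᵥ g) := by
      rw [det_unique, ← replicateCol_mulVec]
      simp [Matrix.mul_apply, dotProduct]
    rw [this]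
    ring
  have h4 : 0 ≤ (w.1ᵀ *ᵥ g) ⬝ᵥ (w.1ᵀ *ᵥ g) :=
    Finset.sum_nonneg fun i _ => mul_self_nonneg _
  rw [gramPow, h3, abs_mul, Complex.ofReal_mul,
    Complex.mul_cpow_ofReal_nonneg (abs_nonneg _) (abs_nonneg _), abs_of_nonneg h4]
  rfl

/-! ### Topology and measurability of frames and of the action. -/

instance matrixSecondCountableTopology (n m : ℕ) :
    SecondCountableTopology (Matrix (Fin n) (Fin m) ℝ) :=
  inferInstanceAs (SecondCountableTopology (Fin n → Fin m → ℝ))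

instance matrixPolishSpace (n m : ℕ) : PolishSpace (Matrix (Fin n) (Fin m) ℝ) :=
  inferInstanceAs (PolishSpace (Fin n → Fin m → ℝ))

instance stiefelSecondCountableTopology (n m : ℕ) : SecondCountableTopology (Stiefel n m) :=
  TopologicalSpace.Subtype.secondCountableTopology
    {v : Matrix (Fin n) (Fin m) ℝ | v.transpose * v = 1}

instance stiefelBorelSpace (n m : ℕ) : BorelSpace (Stiefel n m) :=
  Subtype.borelSpace {v : Matrix (Fin n) (Fin m) ℝ | v.transpose * v = 1}

/-- Used to descend measurability along the surjective orbit map in `measurable_fiberMeasure`. -/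
instance orthogonalGroup_polishSpace (n : ℕ) : PolishSpace (orthogonalGroup (Fin n) ℝ) := by
  have hset : ((orthogonalGroup (Fin n) ℝ : Set (Matrix (Fin n) (Fin n) ℝ))) =
      {g : Matrix (Fin n) (Fin n) ℝ | gᵀ * g = 1} := by
    ext g
    exact mem_orthogonalGroup_iff' (Fin n) ℝ
  have hcl : IsClosed (orthogonalGroup (Fin n) ℝ : Set (Matrix (Fin n) (Fin n) ℝ)) := by
    rw [hset]
    exact isClosed_eq (by fun_prop) continuous_const
  exact hcl.polishSpace

theorem continuous_frameMul {n p m : ℕ} :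
    Continuous fun x : Stiefel n p × Stiefel p m => frameMul x.1 x.2 :=
  Continuous.subtype_mk (by fun_prop) _

theorem measurable_frameMul {n p m : ℕ} :
    Measurable fun x : Stiefel n p × Stiefel p m => frameMul x.1 x.2 :=
  continuous_frameMul.measurable

theorem measurable_frameMul_left {n p m : ℕ} (w : Stiefel n p) :
    Measurable (frameMul w : Stiefel p m → Stiefel n m) :=
  measurable_frameMul.comp measurable_prodMk_left

theorem continuous_act {n m : ℕ} :
    Continuous fun x : orthogonalGroup (Fin n) ℝ × Stiefel n m => act x.1 x.2 :=
  Continuous.subtype_mk (by unfold orthFrame; fun_prop) _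

theorem measurable_act {n m : ℕ} :
    Measurable fun x : orthogonalGroup (Fin n) ℝ × Stiefel n m => act x.1 x.2 :=
  continuous_act.measurable

theorem measurable_act_left {n m : ℕ} (g : orthogonalGroup (Fin n) ℝ) :
    Measurable (act g : Stiefel n m → Stiefel n m) :=
  measurable_act.comp measurable_prodMk_left

theorem measurable_act_right {n m : ℕ} (v : Stiefel n m) :
    Measurable fun g : orthogonalGroup (Fin n) ℝ => act g v :=
  measurable_act.comp measurable_prodMk_right

/-! ### Invariant measures on Stiefel manifolds. -/

/-- The normalized Haar measure of `O(n)`. -/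
noncomputable abbrev orthHaar (n : ℕ) : Measure (orthogonalGroup (Fin n) ℝ) :=
  Measure.haarMeasure ⊤

instance isProbabilityMeasure_orthHaar (n : ℕ) : IsProbabilityMeasure (orthHaar n) :=
  ⟨Measure.haarMeasure_self⟩

/-- A right translate of Haar measure is again a left Haar probability measure, hence the same one
by uniqueness. -/
theorem map_mul_right_orthHaar {n : ℕ} (g : orthogonalGroup (Fin n) ℝ) :
    (orthHaar n).map (· * g) = orthHaar n := by
  have hp : IsProbabilityMeasure ((orthHaar n).map (· * g)) :=
    Measure.isProbabilityMeasure_map (measurable_mul_const g).aemeasurable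
  exact Measure.isHaarMeasure_eq_of_isProbabilityMeasure _ _

/-- A change of base point is a right translation of the group variable, which Haar measure does not
see. -/
theorem stiefelMeasure_eq_map_act {n m : ℕ} (h : m ≤ n) (v : Stiefel n m) :
    stiefelMeasure n m = (orthHaar n).map fun g => act g v := by
  obtain ⟨g, hg⟩ := exists_act_eq h (leadingFrame h 1) v
  have h1 : (fun g' : orthogonalGroup (Fin n) ℝ => act g' v) =
      (fun g' => act g' (leadingFrame h 1)) ∘ (· * g) := by
    ext1 g'
    rw [Function.comp, mul_act, hg]
  rw [h1, ← Measure.map_map (measurable_act_right _) (measurable_mul_const g),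
    map_mul_right_orthHaar, stiefelMeasure, dif_pos h]
  congr 1
  ext1 g'
  exact leadingFrame_eq_act h g'

theorem isProbabilityMeasure_stiefelMeasure {n m : ℕ} (h : m ≤ n) :
    IsProbabilityMeasure (stiefelMeasure n m) := by
  rw [stiefelMeasure_eq_map_act h (leadingFrame h 1)]
  exact Measure.isProbabilityMeasure_map (measurable_act_right _).aemeasurable

theorem map_act_stiefelMeasure {n m : ℕ} (h : m ≤ n) (g : orthogonalGroup (Fin n) ℝ) :
    (stiefelMeasure n m).map (act g) = stiefelMeasure n m := by
  rw [stiefelMeasure_eq_map_act h (leadingFrame h 1),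
    Measure.map_map (measurable_act_left g) (measurable_act_right _)]
  have h1 : act g ∘ (fun g' => act g' (leadingFrame h 1)) =
      (fun g' => act g' (leadingFrame h 1)) ∘ (g * ·) := by
    ext1 g'
    exact (mul_act _ _ _).symm
  rw [h1, ← Measure.map_map (measurable_act_right _) (measurable_const_mul g),
    map_mul_left_eq_self]

theorem measurePreserving_act {n m : ℕ} (h : m ≤ n) (g : orthogonalGroup (Fin n) ℝ) :
    MeasurePreserving (act g) (stiefelMeasure n m) (stiefelMeasure n m) :=
  ⟨measurable_act_left g, map_act_stiefelMeasure h g⟩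

theorem act_inv_act {n m : ℕ} (g : orthogonalGroup (Fin n) ℝ) (v : Stiefel n m) :
    act g⁻¹ (act g v) = v := by
  rw [← mul_act, inv_mul_cancel]
  exact Subtype.ext (Matrix.one_mul _)

theorem measurableEmbedding_act {n m : ℕ} (g : orthogonalGroup (Fin n) ℝ) :
    MeasurableEmbedding (act g : Stiefel n m → Stiefel n m) :=
  MeasurableEquiv.measurableEmbedding
    { toFun := act g
      invFun := act g⁻¹
      left_inv := act_inv_act g
      right_inv := fun v => by simpa using act_inv_act g⁻¹ v
      measurable_toFun := measurable_act_left g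
      measurable_invFun := measurable_act_left g⁻¹ }

/-! ### Fiber measures and the law of an orthogonal pair of frames. -/

theorem complementaryFrame_spec {n k : ℕ} (u : Stiefel n k) :
    u.1ᵀ * (complementaryFrame u).1 = 0 :=
  Classical.choose_spec (exists_complementary_frame u)

/-- The fiber measure does not depend on the choice of the complementary frame. -/
theorem fiberMeasure_eq_map {n k m : ℕ} (hk : k ≤ n) (hm : m ≤ n - k) (u : Stiefel n k)
    (w : Stiefel n (n - k)) (hw : u.1ᵀ * w.1 = 0) :
    fiberMeasure m u = (stiefelMeasure (n - k) m).map (frameMul w) := by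
  set w' := complementaryFrame u
  have hw' : u.1ᵀ * w'.1 = 0 := complementaryFrame_spec u
  have hwu : w.1ᵀ * u.1 = 0 := by
    rw [← transpose_transpose (w.1ᵀ * u.1), transpose_mul, transpose_transpose, hw,
      transpose_zero]
  have h1 : w.1 * (w.1ᵀ * w'.1) = w'.1 := by
    have := mul_transpose_add_mul_transpose hk u w hw
    rw [← Matrix.mul_assoc, eq_sub_of_add_eq' this, Matrix.sub_mul, Matrix.one_mul,
      Matrix.mul_assoc, hw', Matrix.mul_zero, sub_zero]
  have h2 : (w.1ᵀ * w'.1)ᵀ * (w.1ᵀ * w'.1) = 1 := by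
    rw [transpose_mul, transpose_transpose, Matrix.mul_assoc, h1, w'.2]
  -- The change of basis between the two complementary frames; it is absorbed by the
  -- O(n-k)-invariance on V_{n-k,m}.
  let q : orthogonalGroup (Fin (n - k)) ℝ :=
    ⟨w.1ᵀ * w'.1, (mem_orthogonalGroup_iff' _ ℝ).2 h2⟩
  have h3 : (frameMul w' : Stiefel (n - k) m → Stiefel n m) = frameMul w ∘ act q := by
    ext1 ω
    apply Subtype.ext
    change w'.1 * ω.1 = w.1 * (w.1ᵀ * w'.1 * ω.1)
    rw [← Matrix.mul_assoc, h1]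
  change (stiefelMeasure (n - k) m).map (frameMul w') = _
  rw [h3, ← Measure.map_map (measurable_frameMul_left w) (measurable_act_left q),
    map_act_stiefelMeasure hm]

theorem isProbabilityMeasure_fiberMeasure {n k m : ℕ} (hm : m ≤ n - k) (u : Stiefel n k) :
    IsProbabilityMeasure (fiberMeasure m u) := by
  have := isProbabilityMeasure_stiefelMeasure hm
  exact Measure.isProbabilityMeasure_map (measurable_frameMul_left _).aemeasurable

theorem fiberMeasure_act {n k m : ℕ} (hk : k ≤ n) (hm : m ≤ n - k) (u : Stiefel n k)
    (g : orthogonalGroup (Fin n) ℝ) :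
    fiberMeasure m (act g u) = (fiberMeasure m u).map (act g) := by
  have h1 : (act g u).1ᵀ * (act g (complementaryFrame u)).1 = 0 := by
    rw [act_val, act_val, transpose_mul, Matrix.mul_assoc, ← Matrix.mul_assoc _ g.1,
      orthogonal_transpose_mul, Matrix.one_mul, complementaryFrame_spec]
  rw [fiberMeasure_eq_map hk hm _ _ h1, fiberMeasure,
    Measure.map_map (measurable_act_left g) (measurable_frameMul_left _)]
  congr 1
  ext1 ω
  exact (act_frameMul g _ ω).symm

theorem ae_fiberMeasure_orthogonal {n k m : ℕ} (u : Stiefel n k) :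
    ∀ᵐ v : Stiefel n m ∂(fiberMeasure m u), u.1ᵀ * v.1 = 0 := by
  have hmeas : MeasurableSet {v : Stiefel n m | u.1ᵀ * v.1 = 0} :=
    (isClosed_eq (by fun_prop) continuous_const).measurableSet
  rw [fiberMeasure, ae_map_iff (measurable_frameMul_left _).aemeasurable hmeas]
  refine Filter.Eventually.of_forall fun ω => ?_
  change u.1ᵀ * ((complementaryFrame u).1 * ω.1) = 0
  rw [← Matrix.mul_assoc, complementaryFrame_spec, Matrix.zero_mul]

/-- The complementary frame is picked by choice, so measurability cannot be read off the definition.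
Along g ↦ g u the fiber measure becomes the image of a fixed measure under g, which is measurable in
g. -/
theorem measurable_fiberMeasure {n k m : ℕ} (hk : k ≤ n) (hm : m ≤ n - k) :
    Measurable (fiberMeasure m : Stiefel n k → Measure (Stiefel n m)) := by
  let u := leadingFrame hk 1
  have hp := isProbabilityMeasure_fiberMeasure hm u
  rw [← Measurable.measurable_comp_iff_of_surjective (measurable_act_right u)
    (fun v => exists_act_eq hk u v)]
  have h1 : fiberMeasure m ∘ (fun g => act g u) = fun g => (fiberMeasure m u).map (act g) := by
    ext1 g
    exact fiberMeasure_act hk hm u g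
  rw [h1]
  refine Measure.measurable_of_measurable_coe _ fun s hs => ?_
  simp_rw [Measure.map_apply (measurable_act_left _) hs]
  exact measurable_measure_prodMk_left (measurable_act hs)

/-- The fiber measures as a Markov kernel. -/
noncomputable def fiberKernel {n k m : ℕ} (hk : k ≤ n) (hm : m ≤ n - k) :
    Kernel (Stiefel n k) (Stiefel n m) :=
  ⟨fiberMeasure m, measurable_fiberMeasure hk hm⟩

instance isMarkovKernel_fiberKernel {n k m : ℕ} (hk : k ≤ n) (hm : m ≤ n - k) :
    IsMarkovKernel (fiberKernel hk hm) :=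
  ⟨isProbabilityMeasure_fiberMeasure hm⟩

/-- The law of `(u, v)`, with `u` uniform on `V_{n,k}` and `v` uniform on the frames orthogonal
to `u`, is the orbit measure of any pair of orthogonal frames. -/
theorem compProd_fiberKernel {n k m : ℕ} (h : k + m ≤ n) (hk : k ≤ n) (hm : m ≤ n - k)
    (a : Stiefel n k) (b : Stiefel n m) (hab : a.1ᵀ * b.1 = 0) :
    stiefelMeasure n k ⊗ₘ fiberKernel hk hm =
      (orthHaar n).map fun g => (act g a, act g b) := by
  have := isProbabilityMeasure_stiefelMeasure hk
  have := isProbabilityMeasure_fiberMeasure hm a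
  have hab_meas : ∀ (x : Stiefel n k) (y : Stiefel n m),
      Measurable fun g : orthogonalGroup (Fin n) ℝ => (act g x, act g y) :=
    fun x y => (measurable_act_right x).prodMk (measurable_act_right y)
  ext s hs
  rw [Measure.compProd_apply hs, stiefelMeasure_eq_map_act hk a,
    lintegral_map (Kernel.measurable_kernel_prodMk_left hs) (measurable_act_right a)]
  have h1 : ∀ g, fiberKernel hk hm (act g a) (Prod.mk (act g a) ⁻¹' s) =
      ∫⁻ v, s.indicator 1 (act g a, act g v) ∂(fiberMeasure m a) := by
    intro g
    have hms : MeasurableSet (Prod.mk (act g a) ⁻¹' s) := measurable_prodMk_left hs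
    change fiberMeasure m (act g a) _ = _
    rw [fiberMeasure_act hk hm, ← lintegral_indicator_one hms,
      lintegral_map (measurable_one.indicator hms) (measurable_act_left g)]
    rfl
  simp_rw [h1]
  rw [lintegral_lintegral_swap]
  -- A frame v orthogonal to a gives a pair (a, v) = g₀(a, b), and right invariance of Haar measure
  -- removes g₀: the inner integral does not depend on v.
  · have h2 : ∀ᵐ v ∂(fiberMeasure m a),
        ∫⁻ g, s.indicator 1 (act g a, act g v) ∂(orthHaar n) =
          (orthHaar n).map (fun g => (act g a, act g b)) s := by
      filter_upwards [ae_fiberMeasure_orthogonal a] with v hv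
      obtain ⟨g₀, hga, hgb⟩ := exists_act_eq_and_act_eq h hab hv
      rw [← lintegral_indicator_one hs, ← map_mul_right_orthHaar g₀,
        Measure.map_map (hab_meas a b) (measurable_mul_const g₀),
        map_mul_right_orthHaar,
        lintegral_map (measurable_one.indicator hs)
          ((hab_meas a b).comp (measurable_mul_const g₀))]
      simp only [Function.comp, mul_act, hga, hgb]
    rw [lintegral_congr_ae h2]
    simp
  · refine Measurable.aemeasurable ?_
    refine (measurable_one.indicator hs).comp ?_
    exact ((measurable_act_right a).comp measurable_fst).prodMk measurable_act

theorem exists_orthogonal_pair {n k m : ℕ} (h : k + m ≤ n) :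
    ∃ (a : Stiefel n k) (b : Stiefel n m), a.1ᵀ * b.1 = 0 := by
  let a : Stiefel n k := leadingFrame (by omega) 1
  refine ⟨a, frameMul (complementaryFrame a) (leadingFrame (by omega) 1), ?_⟩
  change a.1ᵀ * ((complementaryFrame a).1 * _) = 0
  rw [← Matrix.mul_assoc, complementaryFrame_spec, Matrix.zero_mul]

/-- Orthogonality of frames is a symmetric relation, also for the invariant measures. -/
theorem map_swap_compProd_fiberKernel {n k m : ℕ} (hk : k ≤ n) (hm : m ≤ n)
    (hm' : m ≤ n - k) (hk' : k ≤ n - m) :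
    (stiefelMeasure n k ⊗ₘ fiberKernel hk hm').map Prod.swap =
      stiefelMeasure n m ⊗ₘ fiberKernel hm hk' := by
  obtain ⟨a, b, hab⟩ := exists_orthogonal_pair (n := n) (k := k) (m := m) (by omega)
  have hba : b.1ᵀ * a.1 = 0 := by
    rw [← transpose_transpose (b.1ᵀ * a.1), transpose_mul, transpose_transpose, hab,
      transpose_zero]
  rw [compProd_fiberKernel (by omega) hk hm' a b hab,
    compProd_fiberKernel (by omega) hm hk' b a hba,
    Measure.map_map measurable_swap ((measurable_act_right a).prodMk (measurable_act_right b))]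
  rfl

/-! ### Gaussian vectors: coordinates in a frame and moments of the norm. -/

/-- The Gaussian density `π^{-d/2} exp (-|x|²)` on `ℝ^d`, as a function of `|x|`. -/
noncomputable def gaussianDensity (d : ℕ) (r : ℝ) : ℝ :=
  Real.pi ^ (-(d : ℝ) / 2) * Real.exp (-r ^ 2)

theorem gaussianDensity_nonneg (d : ℕ) (r : ℝ) : 0 ≤ gaussianDensity d r := by
  unfold gaussianDensity
  positivity

theorem continuous_gaussianDensity (d : ℕ) : Continuous (gaussianDensity d) := by
  unfold gaussianDensity
  fun_prop

/-- The Gaussian measure with density `π^{-d/2} exp (-|x|²)` on `ℝ^d`. -/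
noncomputable def gaussian (d : ℕ) : Measure (EuclideanSpace ℝ (Fin d)) :=
  volume.withDensity fun x => ENNReal.ofReal (gaussianDensity d ‖x‖)

theorem integral_gaussian {d : ℕ} (f : EuclideanSpace ℝ (Fin d) → ℂ) :
    ∫ x, f x ∂(gaussian d) = ∫ x, gaussianDensity d ‖x‖ • f x := by
  rw [gaussian, integral_withDensity_eq_integral_toReal_smul]
  · simp only [ENNReal.toReal_ofReal (gaussianDensity_nonneg d _)]
  · exact ((continuous_gaussianDensity d).comp continuous_norm).measurable.ennreal_ofReal
  · exact Filter.Eventually.of_forall fun _ => ENNReal.ofReal_lt_top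

theorem integrable_gaussian_iff {d : ℕ} (f : EuclideanSpace ℝ (Fin d) → ℂ) :
    Integrable f (gaussian d) ↔ Integrable fun x => gaussianDensity d ‖x‖ • f x := by
  rw [gaussian, integrable_withDensity_iff_integrable_smul']
  · simp only [ENNReal.toReal_ofReal (gaussianDensity_nonneg d _)]
  · exact ((continuous_gaussianDensity d).comp continuous_norm).measurable.ennreal_ofReal
  · exact Filter.Eventually.of_forall fun _ => ENNReal.ofReal_lt_top

instance isFiniteMeasure_gaussian (d : ℕ) : IsFiniteMeasure (gaussian d) := by
  refine isFiniteMeasure_withDensity_ofReal ?_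
  have h := (GaussianFourier.integrable_cexp_neg_mul_sq_norm_add (b := 1) (by simp) 0
    (0 : EuclideanSpace ℝ (Fin d))).norm.const_mul (Real.pi ^ (-(d : ℝ) / 2))
  refine (h.congr (Filter.Eventually.of_forall fun x => ?_)).2
  simp only [gaussianDensity, Complex.norm_exp]
  congr 2
  simp [← Complex.ofReal_pow]

theorem charFun_gaussian (d : ℕ) (t : EuclideanSpace ℝ (Fin d)) :
    charFun (gaussian d) t = Complex.exp (-(‖t‖ ^ 2 / 4)) := by
  rw [charFun_apply, integral_gaussian]
  have h1 : ∀ x : EuclideanSpace ℝ (Fin d),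
      gaussianDensity d ‖x‖ • Complex.exp ((inner ℝ x t : ℝ) * Complex.I) =
        ((Real.pi ^ (-(d : ℝ) / 2) : ℝ) : ℂ) *
          Complex.exp (-1 * (‖x‖ : ℂ) ^ 2 + Complex.I * (inner ℝ t x : ℝ)) := by
    intro x
    rw [gaussianDensity, Complex.real_smul, Complex.ofReal_mul, Complex.exp_add,
      real_inner_comm, mul_comm Complex.I, mul_assoc]
    push_cast
    ring_nf
  simp_rw [h1]
  rw [integral_const_mul, GaussianFourier.integral_cexp_neg_mul_sq_norm_add (by simp)]
  have h2 : ((Real.pi : ℂ) / 1) ^ ((Module.finrank ℝ (EuclideanSpace ℝ (Fin d)) : ℂ) / 2) =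
      ((Real.pi ^ ((d : ℝ) / 2) : ℝ) : ℂ) := by
    rw [finrank_euclideanSpace_fin, div_one, Complex.ofReal_cpow Real.pi_pos.le]
    push_cast
    rfl
  rw [h2, ← mul_assoc, ← Complex.ofReal_mul, ← Real.rpow_add Real.pi_pos]
  rw [show -(d : ℝ) / 2 + d / 2 = 0 by ring, Real.rpow_zero, Complex.ofReal_one, one_mul,
    Complex.I_sq]
  congr 1
  ring

theorem inner_eq_dotProduct {d : ℕ} (x y : EuclideanSpace ℝ (Fin d)) :
    inner ℝ x y = x.ofLp ⬝ᵥ y.ofLp := by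
  simp [PiLp.inner_apply, dotProduct, mul_comm]

/-- The linear map given by the transpose of a frame. -/
noncomputable def frameCoord {n d : ℕ} (w : Stiefel n d) (x : EuclideanSpace ℝ (Fin n)) :
    EuclideanSpace ℝ (Fin d) :=
  WithLp.toLp 2 (w.1ᵀ *ᵥ x.ofLp)

theorem continuous_frameCoord {n d : ℕ} (w : Stiefel n d) : Continuous (frameCoord w) := by
  unfold frameCoord
  fun_prop

/-- The coordinates of a Gaussian vector with respect to an orthonormal frame are Gaussian. -/
theorem map_frameCoord_gaussian {n d : ℕ} (w : Stiefel n d) :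
    (gaussian n).map (frameCoord w) = gaussian d := by
  have hw := (continuous_frameCoord w).measurable
  refine Measure.ext_of_charFun (funext fun t => ?_)
  have h1 : ∀ x, inner ℝ (frameCoord w x) t = inner ℝ x (WithLp.toLp 2 (w.1 *ᵥ t.ofLp)) := by
    intro x
    rw [inner_eq_dotProduct, inner_eq_dotProduct]
    simp only [frameCoord]
    rw [mulVec_transpose, ← dotProduct_mulVec]
  -- A frame acts isometrically, and the Gaussian characteristic function depends on the norm only.
  have h2 : ‖WithLp.toLp 2 (w.1 *ᵥ t.ofLp)‖ ^ 2 = ‖t‖ ^ 2 := by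
    rw [← real_inner_self_eq_norm_sq, ← real_inner_self_eq_norm_sq, inner_eq_dotProduct,
      inner_eq_dotProduct]
    simp only
    rw [dotProduct_mulVec, ← mulVec_transpose, mulVec_mulVec, w.2, one_mulVec]
  rw [charFun_gaussian, charFun_apply, integral_map hw.aemeasurable (by fun_prop)]
  simp_rw [h1]
  rw [← charFun_apply, charFun_gaussian, ← Complex.ofReal_pow, h2, Complex.ofReal_pow]

theorem normSq_frameCoord {n d : ℕ} (w : Stiefel n d) (x : EuclideanSpace ℝ (Fin n)) :
    (w.1ᵀ *ᵥ x.ofLp) ⬝ᵥ (w.1ᵀ *ᵥ x.ofLp) = ‖frameCoord w x‖ ^ 2 := by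
  rw [← real_inner_self_eq_norm_sq, inner_eq_dotProduct]
  rfl

section Radial

variable {d : ℕ} {s : ℂ}

/-- The substitution x = y² in Euler's integral for Γ(d/2 + s). -/
theorem radial_integrand_eq (hd : 1 ≤ d) {y : ℝ} (hy : 0 < y) :
    ((2 : ℝ) * y ^ ((2 : ℝ) - 1)) •
        (((Real.exp (-(y ^ (2 : ℝ))) : ℝ) : ℂ) * ((y ^ (2 : ℝ) : ℝ) : ℂ) ^ ((d : ℂ) / 2 + s - 1)) =
      2 * (y ^ (d - 1) • (((Real.exp (-y ^ 2) : ℝ) : ℂ) * ((y ^ 2 : ℝ) : ℂ) ^ s)) := by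
  have hy2 : (0 : ℝ) < y ^ 2 := by positivity
  have h1 : ((y ^ 2 : ℝ) : ℂ) ^ ((d : ℂ) / 2 + s - 1) =
      ((y ^ ((d : ℝ) - 2) : ℝ) : ℂ) * ((y ^ 2 : ℝ) : ℂ) ^ s := by
    rw [show (d : ℂ) / 2 + s - 1 = (((d : ℝ) - 2) / 2 : ℝ) + s by push_cast; ring,
      Complex.cpow_add _ _ (by exact_mod_cast hy2.ne'), ← Complex.ofReal_cpow hy2.le,
      ← Real.rpow_natCast_mul hy.le]
    congr 4
    push_cast
    ring
  have h2 : y ^ (d - 1) = y * y ^ ((d : ℝ) - 2) := by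
    nth_rw 2 [← Real.rpow_one y]
    rw [← Real.rpow_natCast, Nat.cast_sub hd, ← Real.rpow_add hy]
    congr 1
    push_cast
    ring
  rw [Real.rpow_two, h1, h2, show (2 : ℝ) - 1 = 1 by norm_num, Real.rpow_one,
    Complex.real_smul, Complex.real_smul]
  push_cast
  ring

theorem integrableOn_radial (hd : 1 ≤ d) (hs : 0 < ((d : ℂ) / 2 + s).re) :
    IntegrableOn (fun y : ℝ => y ^ (d - 1) •
      (((Real.exp (-y ^ 2) : ℝ) : ℂ) * ((y ^ 2 : ℝ) : ℂ) ^ s)) (Ioi 0) := by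
  have h := (integrableOn_Ioi_comp_rpow_iff _ (two_ne_zero (α := ℝ))).2
    (Complex.GammaIntegral_convergent hs)
  rw [abs_two] at h
  have h2 := (h.congr_fun (fun y hy => radial_integrand_eq hd hy) measurableSet_Ioi).const_mul
    (1 / 2 : ℂ)
  refine h2.congr (Filter.Eventually.of_forall fun y => ?_)
  ring

theorem integral_radial (hd : 1 ≤ d) (hs : 0 < ((d : ℂ) / 2 + s).re) :
    ∫ y in Ioi (0 : ℝ), y ^ (d - 1) • (((Real.exp (-y ^ 2) : ℝ) : ℂ) * ((y ^ 2 : ℝ) : ℂ) ^ s) =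
      Complex.Gamma ((d : ℂ) / 2 + s) / 2 := by
  have h := integral_comp_rpow_Ioi_of_pos (g := fun x : ℝ => ((Real.exp (-x) : ℝ) : ℂ) *
    (x : ℂ) ^ ((d : ℂ) / 2 + s - 1)) two_pos
  rw [setIntegral_congr_fun measurableSet_Ioi
    (fun y (hy : 0 < y) => radial_integrand_eq (s := s) hd hy), integral_const_mul] at h
  rw [Complex.Gamma_eq_integral hs, Complex.GammaIntegral, ← h]
  ring

theorem gaussianDensity_smul_eq (r : ℝ) :
    gaussianDensity d r • ((r ^ 2 : ℝ) : ℂ) ^ s =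
      ((Real.pi ^ (-(d : ℝ) / 2) : ℝ) : ℂ) *
        (((Real.exp (-r ^ 2) : ℝ) : ℂ) * ((r ^ 2 : ℝ) : ℂ) ^ s) := by
  rw [gaussianDensity, Complex.real_smul, Complex.ofReal_mul, mul_assoc]

theorem integrable_normSq_cpow_gaussian (hd : 1 ≤ d) (hs : 0 < ((d : ℂ) / 2 + s).re) :
    Integrable (fun x => ((‖x‖ ^ 2 : ℝ) : ℂ) ^ s) (gaussian d) := by
  have : Nonempty (Fin d) := ⟨⟨0, hd⟩⟩
  rw [integrable_gaussian_iff]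
  simp_rw [gaussianDensity_smul_eq]
  refine Integrable.const_mul ?_ _
  rw [integrable_fun_norm_addHaar volume
    (f := fun r : ℝ => ((Real.exp (-r ^ 2) : ℝ) : ℂ) * ((r ^ 2 : ℝ) : ℂ) ^ s),
    finrank_euclideanSpace_fin]
  exact integrableOn_radial hd hs

/-- The moments of the squared norm of a Gaussian vector. -/
theorem integral_normSq_cpow_gaussian (hd : 1 ≤ d) (hs : 0 < ((d : ℂ) / 2 + s).re) :
    ∫ x, ((‖x‖ ^ 2 : ℝ) : ℂ) ^ s ∂(gaussian d) =
      Complex.Gamma ((d : ℂ) / 2 + s) / Complex.Gamma ((d : ℂ) / 2) := by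
  have : Nonempty (Fin d) := ⟨⟨0, hd⟩⟩
  have hd0 : 0 < ((d : ℂ) / 2 + 0).re := by
    rw [add_zero, show (d : ℂ) / 2 = ((d / 2 : ℝ) : ℂ) by push_cast; rfl, Complex.ofReal_re]
    have : (0 : ℝ) < d := by exact_mod_cast hd
    positivity
  -- C does not depend on the exponent, so the exponent 0, where the integral is the total mass 1,
  -- gives C = 1/Γ(d/2) without computing the volume of the ball.
  obtain ⟨C, hC⟩ : ∃ C : ℂ, ∀ z : ℂ, 0 < ((d : ℂ) / 2 + z).re →
      ∫ x, ((‖x‖ ^ 2 : ℝ) : ℂ) ^ z ∂(gaussian d) = C * Complex.Gamma ((d : ℂ) / 2 + z) := by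
    refine ⟨((Real.pi ^ (-(d : ℝ) / 2) : ℝ) : ℂ) * (d * ((volume.real
      (Metric.ball (0 : EuclideanSpace ℝ (Fin d)) 1) : ℝ) : ℂ)) / 2, fun z hz => ?_⟩
    rw [integral_gaussian]
    simp_rw [gaussianDensity_smul_eq]
    rw [integral_const_mul, integral_fun_norm_addHaar volume
      (fun r : ℝ => ((Real.exp (-r ^ 2) : ℝ) : ℂ) * ((r ^ 2 : ℝ) : ℂ) ^ z),
      finrank_euclideanSpace_fin, integral_radial hd hz, Complex.real_smul, nsmul_eq_mul]
    ring
  have h0 : C * Complex.Gamma ((d : ℂ) / 2) = 1 := by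
    have h1 := hC 0 hd0
    have h2 := charFun_gaussian d 0
    rw [charFun_apply] at h2
    simp only [Complex.cpow_zero, add_zero] at h1
    simp only [inner_zero_right, Complex.ofReal_zero, zero_mul, Complex.exp_zero, norm_zero] at h2
    rw [← h1, h2]
    simp
  have hne : Complex.Gamma ((d : ℂ) / 2) ≠ 0 := right_ne_zero_of_mul_eq_one h0
  rw [hC s hs, eq_div_iff hne, mul_right_comm, h0, one_mul]

end Radial

/-! ### The integral of |Aᵀuuᵀ A|^s over the Stiefel manifold. -/

theorem act_inv_transpose_mul {n k m : ℕ} (g : orthogonalGroup (Fin n) ℝ) (u : Stiefel n k)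
    (v : Stiefel n m) : (act g⁻¹ u).1ᵀ * v.1 = u.1ᵀ * (act g v).1 := by
  rw [act_val, act_val, transpose_mul, Matrix.mul_assoc]
  rfl

theorem continuous_snocCol {p m : ℕ} :
    Continuous fun x : Matrix (Fin p) (Fin m) ℝ × (Fin p → ℝ) => snocCol x.1 x.2 := by
  refine continuous_matrix fun i j => ?_
  unfold snocCol
  simp only [submatrix_apply, id]
  cases finSumFinEquiv.symm j with
  | inl j => simpa using (by fun_prop)
  | inr j => simpa using (by fun_prop)

/-- The `O(n)`-invariance and homogeneity of `A ↦ ∫ |Aᵀuuᵀ A|^s d_*u`. -/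
theorem integral_gramPow_transpose_mul_of_frame {s : ℂ} {n k m : ℕ} (hk : k ≤ n) (hm : m ≤ n)
    (v : Stiefel n m)
    (hv : Integrable (fun u : Stiefel n k => gramPow s (u.1ᵀ * v.1)) (stiefelMeasure n k))
    (A : Matrix (Fin n) (Fin m) ℝ) :
    Integrable (fun u : Stiefel n k => gramPow s (u.1ᵀ * A)) (stiefelMeasure n k) ∧
      ∫ u : Stiefel n k, gramPow s (u.1ᵀ * A) ∂(stiefelMeasure n k) =
        (∫ u : Stiefel n k, gramPow s (u.1ᵀ * v.1) ∂(stiefelMeasure n k)) * gramPow s A := by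
  -- With A = θB both sides scale by |BᵀB|^s, and θ = g v is reduced to v by invariance.
  obtain ⟨θ, B, rfl⟩ := exists_frame_mul_eq hm A
  obtain ⟨g, rfl⟩ := exists_act_eq hm v θ
  simp_rw [← Matrix.mul_assoc, gramPow_mul, gramPow_frame, one_mul, ← act_inv_transpose_mul]
  have hg := measurePreserving_act (m := k) hk g⁻¹
  refine ⟨Integrable.mul_const ?_ _, ?_⟩
  · exact (hg.integrable_comp_emb (measurableEmbedding_act _)).2 hv
  · rw [integral_mul_const]
    congr 1
    exact hg.integral_comp (measurableEmbedding_act _)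
      (fun u : Stiefel n k => gramPow s (u.1ᵀ * v.1))

/-- The moment `Γ(d/2 + s) / Γ(d/2)` of the squared norm of a Gaussian vector. -/
noncomputable def gaussMoment (s d : ℂ) : ℂ := Complex.Gamma (d / 2 + s) / Complex.Gamma (d / 2)

theorem gaussMoment_ne_zero {s d : ℂ} (hd : 0 < d.re) (hs : 0 < (d / 2 + s).re) :
    gaussMoment s d ≠ 0 :=
  div_ne_zero (Complex.Gamma_ne_zero_of_re_pos hs)
    (Complex.Gamma_ne_zero_of_re_pos (by simpa using hd))

/-- The last clause, an L¹ norm independent of w, supplies the uniform bound needed for Fubini in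
`integral_gramPow_transpose_mul`. -/
theorem integral_normSq_frameCoord_cpow {s : ℂ} {n d : ℕ} (hd : 1 ≤ d)
    (hs : 0 < ((d : ℂ) / 2 + s).re) (w : Stiefel n d) :
    Integrable (fun x => ((‖frameCoord w x‖ ^ 2 : ℝ) : ℂ) ^ s) (gaussian n) ∧
      ∫ x, ((‖frameCoord w x‖ ^ 2 : ℝ) : ℂ) ^ s ∂(gaussian n) = gaussMoment s d ∧
      ∫ x, ‖((‖frameCoord w x‖ ^ 2 : ℝ) : ℂ) ^ s‖ ∂(gaussian n) =
        ∫ y, ‖((‖y‖ ^ 2 : ℝ) : ℂ) ^ s‖ ∂(gaussian d) := by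
  have hw := (continuous_frameCoord w).measurable.aemeasurable (μ := gaussian n)
  have hI := integrable_normSq_cpow_gaussian hd hs
  have h1 := integral_normSq_cpow_gaussian hd hs
  rw [← map_frameCoord_gaussian w] at hI h1 ⊢
  refine ⟨hI.comp_aemeasurable hw, ?_, ?_⟩
  · rwa [integral_map hw hI.1] at h1
  · rw [integral_map hw hI.norm.1]

/-- The constant in `integral_gramPow_transpose_mul`. -/
noncomputable def cosConst (s : ℂ) (n k m : ℕ) : ℂ :=
  ∏ j ∈ Finset.range m, gaussMoment s ((k : ℂ) - j) / gaussMoment s ((n : ℂ) - j)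

/-- Induction on m, averaging over A = [θ x] with θ a fixed m-frame and x Gaussian. For fixed u the
average over x leaves the integrand for θ times the moment in dimension k - m; after integration
over u first, it leaves the unknown constant times the moment in dimension n - m. Comparing the two
orders gives one more factor of `cosConst`. -/
theorem integral_gramPow_transpose_mul {s : ℂ} {n k m : ℕ} (hk : k ≤ n) (hm : m ≤ k)
    (hs : ∀ j < m, 0 < (((k : ℂ) - j) / 2 + s).re) (A : Matrix (Fin n) (Fin m) ℝ) :
    Integrable (fun u : Stiefel n k => gramPow s (u.1ᵀ * A)) (stiefelMeasure n k) ∧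
      ∫ u : Stiefel n k, gramPow s (u.1ᵀ * A) ∂(stiefelMeasure n k) =
        cosConst s n k m * gramPow s A := by
  have hprob := isProbabilityMeasure_stiefelMeasure hk
  induction m with
  | zero => simp [gramPow_of_isEmpty, cosConst]
  | succ m ih =>
    have hmn : m ≤ n := by omega
    let θ : Stiefel n m := leadingFrame hmn 1
    let w : Stiefel n (n - m) := complementaryFrame θ
    obtain ⟨ihI, ihE⟩ := ih (by omega) (fun j hj => hs j (by omega)) θ.1
    rw [gramPow_frame, mul_one] at ihE
    have hkm : ((k - m : ℕ) : ℂ) = (k : ℂ) - m := by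
      rw [Nat.cast_sub (by omega)]
    have hnm : ((n - m : ℕ) : ℂ) = (n : ℂ) - m := by
      rw [Nat.cast_sub (by omega)]
    have hsk : 0 < (((k - m : ℕ) : ℂ) / 2 + s).re := by
      rw [hkm]
      exact hs m (by omega)
    have hsn : 0 < (((n - m : ℕ) : ℂ) / 2 + s).re := by
      have h1 : ((k - m : ℕ) : ℝ) ≤ ((n - m : ℕ) : ℝ) := by
        exact_mod_cast (by omega : k - m ≤ n - m)
      have h2 : ∀ l : ℕ, ((l : ℂ) / 2 + s).re = (l : ℝ) / 2 + s.re := by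
        intro l
        simp
      rw [h2] at hsk ⊢
      linarith
    have hJn : gaussMoment s ((n : ℂ) - m) ≠ 0 := by
      rw [← hnm]
      refine gaussMoment_ne_zero ?_ hsn
      rw [Complex.natCast_re]
      exact_mod_cast (by omega : 0 < n - m)
    let H : EuclideanSpace ℝ (Fin n) × Stiefel n k → ℂ := fun x =>
      gramPow s (x.2.1ᵀ * snocCol θ.1 x.1.ofLp)
    have hHmeas : Measurable H := by
      refine (measurable_gramPow s).comp (Continuous.measurable ?_)
      have hc : Continuous fun x : EuclideanSpace ℝ (Fin n) × Stiefel n k =>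
          snocCol θ.1 x.1.ofLp := by
        have h : Continuous fun x : EuclideanSpace ℝ (Fin n) × Stiefel n k =>
            (θ.1, x.1.ofLp) := by fun_prop
        exact continuous_snocCol.comp h
      fun_prop
    -- With uᵀθ = θ'B, the distance from uᵀx to the span of θ' is the norm of the coordinates of x
    -- in the (k-m)-frame u w, where w is complementary to θ'.
    have hHframe : ∀ u : Stiefel n k, ∃ w' : Stiefel n (k - m), ∀ x,
        H (x, u) = gramPow s (u.1ᵀ * θ.1) * ((‖frameCoord w' x‖ ^ 2 : ℝ) : ℂ) ^ s := by
      intro u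
      obtain ⟨θ', B, hB⟩ := exists_frame_mul_eq (by omega : m ≤ k) (u.1ᵀ * θ.1)
      refine ⟨frameMul u (complementaryFrame θ'), fun x => ?_⟩
      change gramPow s (u.1ᵀ * snocCol θ.1 x.ofLp) = _
      rw [mul_snocCol, hB, gramPow_snocCol_frame_mul s (by omega) θ' _
        (complementaryFrame_spec θ'), gramPow_mul, gramPow_frame, one_mul,
        ← normSq_frameCoord]
      change _ = gramPow s B * (((((u.1 * (complementaryFrame θ').1)ᵀ *ᵥ x.ofLp) ⬝ᵥ
        ((u.1 * (complementaryFrame θ').1)ᵀ *ᵥ x.ofLp) : ℝ) : ℂ) ^ s)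
      rw [transpose_mul, mulVec_mulVec]
    have hHw : ∀ x : EuclideanSpace ℝ (Fin n),
        gramPow s (snocCol θ.1 x.ofLp) = ((‖frameCoord w x‖ ^ 2 : ℝ) : ℂ) ^ s := by
      intro x
      have h := gramPow_snocCol_frame_mul s hmn θ w (complementaryFrame_spec θ) 1 x.ofLp
      rw [Matrix.mul_one] at h
      rw [h, normSq_frameCoord]
      simp [gramPow]
    have hHint : Integrable H ((gaussian n).prod (stiefelMeasure n k)) := by
      rw [integrable_prod_iff' hHmeas.aestronglyMeasurable]
      constructor
      · refine Filter.Eventually.of_forall fun u => ?_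
        obtain ⟨w', hw'⟩ := hHframe u
        simp_rw [hw']
        exact (integral_normSq_frameCoord_cpow (by omega) hsk w').1.const_mul _
      · refine (ihI.norm.mul_const
          (∫ y, ‖((‖y‖ ^ 2 : ℝ) : ℂ) ^ s‖ ∂(gaussian (k - m)))).congr
          (Filter.Eventually.of_forall fun u => ?_)
        obtain ⟨w', hw'⟩ := hHframe u
        simp_rw [hw', norm_mul]
        rw [integral_const_mul, (integral_normSq_frameCoord_cpow (by omega) hsk w').2.2]
    obtain ⟨hwI, hwE, -⟩ := integral_normSq_frameCoord_cpow (by omega) hsn w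
    -- Almost every x has an integrable section, and the power cannot vanish almost everywhere
    -- because its Gaussian moment is nonzero. Such an x yields one frame θ₁ for which the integral
    -- converges, hence convergence for every A.
    obtain ⟨x, hxI, hx0⟩ : ∃ x, Integrable (fun u => H (x, u)) (stiefelMeasure n k) ∧
        ((‖frameCoord w x‖ ^ 2 : ℝ) : ℂ) ^ s ≠ 0 := by
      by_contra! hcon
      have h0 : ∀ᵐ x ∂(gaussian n), ((‖frameCoord w x‖ ^ 2 : ℝ) : ℂ) ^ s = 0 := by
        filter_upwards [hHint.prod_right_ae] with x hx using hcon x hx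
      rw [integral_congr_ae h0, integral_zero, hnm] at hwE
      exact hJn hwE.symm
    obtain ⟨θ₁, B, hB⟩ := exists_frame_mul_eq (by omega : m + 1 ≤ n) (snocCol θ.1 x.ofLp)
    have hB0 : gramPow s B ≠ 0 := by
      rw [← hHw, hB, gramPow_mul, gramPow_frame, one_mul] at hx0
      exact hx0
    have hθ₁ : Integrable (fun u : Stiefel n k => gramPow s (u.1ᵀ * θ₁.1))
        (stiefelMeasure n k) := by
      refine (hxI.mul_const (gramPow s B)⁻¹).congr (Filter.Eventually.of_forall fun u => ?_)
      change gramPow s (u.1ᵀ * snocCol θ.1 x.ofLp) * _ = _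
      rw [hB, ← Matrix.mul_assoc, gramPow_mul, mul_inv_cancel_right₀ hB0]
    have hhom := integral_gramPow_transpose_mul_of_frame hk (by omega) θ₁ hθ₁
    refine ⟨(hhom A).1, ?_⟩
    rw [(hhom A).2]
    congr 1
    have h1 : ∫ x, ∫ u, H (x, u) ∂(stiefelMeasure n k) ∂(gaussian n) =
        (∫ u : Stiefel n k, gramPow s (u.1ᵀ * θ₁.1) ∂(stiefelMeasure n k)) *
          gaussMoment s ((n : ℂ) - m) := by
      rw [← hnm, ← hwE, ← integral_const_mul]
      refine integral_congr_ae (Filter.Eventually.of_forall fun x => ?_)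
      change ∫ u : Stiefel n k, gramPow s (u.1ᵀ * snocCol θ.1 x.ofLp) ∂_ = _
      rw [(hhom _).2, hHw]
    have h2 : ∫ u, ∫ x, H (x, u) ∂(gaussian n) ∂(stiefelMeasure n k) =
        cosConst s n k m * gaussMoment s ((k : ℂ) - m) := by
      rw [← ihE, ← integral_mul_const]
      refine integral_congr_ae (Filter.Eventually.of_forall fun u => ?_)
      obtain ⟨w', hw'⟩ := hHframe u
      simp_rw [hw']
      rw [integral_const_mul, (integral_normSq_frameCoord_cpow (by omega) hsk w').2.1, hkm]
    have h3 := integral_integral_swap (f := fun x u => H (x, u)) hHint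
    rw [h1, h2] at h3
    rw [eq_div_of_mul_eq hJn h3, cosConst, cosConst, Finset.prod_range_succ, mul_div_assoc]

/-- Allows division by the constant: for integrability against the sine kernel, and for the
telescoping in `cosConst_eq_mul`. -/
theorem cosConst_ne_zero {s : ℂ} {n k m : ℕ} (hk : k ≤ n) (hm : m ≤ k)
    (hs : ∀ j < m, 0 < (((k : ℂ) - j) / 2 + s).re) : cosConst s n k m ≠ 0 := by
  refine Finset.prod_ne_zero_iff.2 fun j hj => ?_
  rw [Finset.mem_range] at hj
  have h1 := hs j hj
  have hjk : (j : ℝ) < k := by exact_mod_cast (by omega : j < k)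
  have hkn : (k : ℝ) ≤ n := by exact_mod_cast hk
  have hre : ∀ l : ℕ, (((l : ℂ) - j) / 2 + s).re = ((l : ℝ) - j) / 2 + s.re := by
    intro l
    simp
  refine div_ne_zero (gaussMoment_ne_zero ?_ h1) (gaussMoment_ne_zero ?_ ?_)
  · simpa using hjk
  · simpa using hjk.trans_le hkn
  · rw [hre] at h1 ⊢
    linarith

/-! ### Integrability of the cosine kernel and its dual Funk transform. -/

theorem cosKernel_act {n m k : ℕ} (s : ℂ) (g : orthogonalGroup (Fin n) ℝ) (v : Stiefel n m)
    (u : Stiefel n k) : cosKernel s (act g v) u = cosKernel s v (act g⁻¹ u) := by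
  rw [cosKernel_eq_gramPow, cosKernel_eq_gramPow, act_inv_transpose_mul]

theorem measurable_cosKernel {n m k : ℕ} (s : ℂ) :
    Measurable fun p : Stiefel n m × Stiefel n k => cosKernel s p.1 p.2 := by
  simp_rw [cosKernel_eq_gramPow]
  exact (measurable_gramPow s).comp (Continuous.measurable (by fun_prop))

/-- The cosine kernel is integrable in each variable, with `L¹` norm independent of the other. -/
theorem exists_integral_norm_cosKernel_eq {n m k : ℕ} (hk : k ≤ n) (hm : m ≤ k) {s : ℂ}
    (hs : ∀ j < m, 0 < (((k : ℂ) - j) / 2 + s).re) :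
    ∃ C C' : ℝ,
      (∀ v : Stiefel n m,
        Integrable (fun u : Stiefel n k => cosKernel s v u) (stiefelMeasure n k) ∧
        ∫ u : Stiefel n k, ‖cosKernel s v u‖ ∂(stiefelMeasure n k) = C) ∧
      ∀ u : Stiefel n k,
        Integrable (fun v : Stiefel n m => cosKernel s v u) (stiefelMeasure n m) ∧
        ∫ v : Stiefel n m, ‖cosKernel s v u‖ ∂(stiefelMeasure n m) = C' := by
  have hmn : m ≤ n := hm.trans hk
  have := isProbabilityMeasure_stiefelMeasure hk
  have := isProbabilityMeasure_stiefelMeasure hmn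
  have hI : ∀ v : Stiefel n m,
      Integrable (fun u : Stiefel n k => cosKernel s v u) (stiefelMeasure n k) := by
    intro v
    simp_rw [cosKernel_eq_gramPow]
    exact (integral_gramPow_transpose_mul hk hm hs v.1).1
  have hC : ∀ v : Stiefel n m, ∫ u : Stiefel n k, ‖cosKernel s v u‖ ∂(stiefelMeasure n k) =
      ∫ u : Stiefel n k, ‖cosKernel s (leadingFrame hmn 1) u‖ ∂(stiefelMeasure n k) := by
    intro v
    obtain ⟨g, rfl⟩ := exists_act_eq hmn (leadingFrame hmn 1) v
    simp_rw [cosKernel_act]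
    exact (measurePreserving_act hk g⁻¹).integral_comp (measurableEmbedding_act _)
      fun u : Stiefel n k => ‖cosKernel s (leadingFrame hmn 1) u‖
  -- The integral formula covers only the variable u. Fubini on the product gives integrability in v
  -- for some u₀, and transitivity carries it to every u.
  have hprod : Integrable (fun p : Stiefel n m × Stiefel n k => cosKernel s p.1 p.2)
      ((stiefelMeasure n m).prod (stiefelMeasure n k)) := by
    rw [integrable_prod_iff (measurable_cosKernel s).aestronglyMeasurable]
    refine ⟨Filter.Eventually.of_forall hI, ?_⟩
    simp_rw [hC]
    exact integrable_const _
  obtain ⟨u₀, hu₀⟩ := hprod.prod_left_ae.exists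
  refine ⟨_, ∫ v : Stiefel n m, ‖cosKernel s v u₀‖ ∂(stiefelMeasure n m),
    fun v => ⟨hI v, hC v⟩, fun u => ?_⟩
  obtain ⟨g, rfl⟩ := exists_act_eq hk u₀ u
  have hg : ∀ v : Stiefel n m, cosKernel s v (act g u₀) = cosKernel s (act g⁻¹ v) u₀ := by
    intro v
    rw [cosKernel_act, inv_inv]
  simp_rw [hg]
  have hmp := measurePreserving_act (m := m) hmn g⁻¹
  exact ⟨(hmp.integrable_comp_emb (measurableEmbedding_act _)).2 hu₀,
    hmp.integral_comp (measurableEmbedding_act _) fun v : Stiefel n m => ‖cosKernel s v u₀‖⟩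

/-- The dual Funk transform of the cosine kernel is a multiple of the sine kernel. -/
theorem integral_cosKernel_fiberMeasure {n m k : ℕ} (hmn : m ≤ n) (hkn : k ≤ n - m)
    (hm : m ≤ k) {s : ℂ} (hs : ∀ j < m, 0 < (((k : ℂ) - j) / 2 + s).re) (v w : Stiefel n m) :
    Integrable (fun u : Stiefel n k => cosKernel s v u) (fiberMeasure k w) ∧
      ∫ u : Stiefel n k, cosKernel s v u ∂(fiberMeasure k w) =
        cosConst s (n - m : ℕ) k m * sinKernel s v w := by
  have hmeas : AEStronglyMeasurable (fun u : Stiefel n k => cosKernel s v u)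
      (fiberMeasure k w) :=
    ((measurable_cosKernel s).comp measurable_prodMk_left).aestronglyMeasurable
  have hw := (measurable_frameMul_left (m := k) (complementaryFrame w)).aemeasurable
    (μ := stiefelMeasure (n - m) k)
  -- A frame orthogonal to w is w̃ω, and (w̃ω)ᵀv = ωᵀ(w̃ᵀv). Since w̃ᵀv need not be a frame, the
  -- integral formula is needed for arbitrary A.
  have h1 : ∀ ω : Stiefel (n - m) k, cosKernel s v (frameMul (complementaryFrame w) ω) =
      gramPow s (ω.1ᵀ * ((complementaryFrame w).1ᵀ * v.1)) := by
    intro ω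
    rw [cosKernel_eq_gramPow, ← Matrix.mul_assoc, ← transpose_mul]
    rfl
  have h2 := integral_gramPow_transpose_mul hkn hm hs ((complementaryFrame w).1ᵀ * v.1)
  rw [sinKernel_eq_gramPow hmn s v w _ (complementaryFrame_spec w)]
  rw [fiberMeasure] at hmeas ⊢
  rw [integrable_map_measure hmeas hw, integral_map hw hmeas]
  simp_rw [Function.comp_def, h1]
  exact h2

/-! ### Fubini on orthogonal pairs and the two compositions. -/

theorem integrable_integral_compProd {X Y : Type*}
    [MeasurableSpace X] [MeasurableSpace Y] {μ : Measure X} [SFinite μ] {κ : Kernel X Y}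
    [IsSFiniteKernel κ] {f : X × Y → ℂ} (hf : Integrable f (μ ⊗ₘ κ)) :
    Integrable (fun x => ∫ y, f (x, y) ∂(κ x)) μ := by
  rw [Measure.compProd] at hf
  simpa using hf.integral_compProd

theorem measurePreserving_fst_compProd_fiberKernel {n m k : ℕ} (hm : m ≤ n) (hk : k ≤ n - m) :
    MeasurePreserving Prod.fst (stiefelMeasure n m ⊗ₘ fiberKernel hm hk)
      (stiefelMeasure n m) := by
  have := isProbabilityMeasure_stiefelMeasure hm
  exact ⟨measurable_fst, Measure.fst_compProd _ _⟩

theorem measurePreserving_swap_compProd_fiberKernel {n m k : ℕ} (hm : m ≤ n) (hk : k ≤ n - m)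
    (hkn : k ≤ n) (hm' : m ≤ n - k) :
    MeasurePreserving Prod.swap (stiefelMeasure n k ⊗ₘ fiberKernel hkn hm')
      (stiefelMeasure n m ⊗ₘ fiberKernel hm hk) :=
  ⟨measurable_swap, map_swap_compProd_fiberKernel hkn hm hm' hk⟩

theorem measurePreserving_snd_compProd_fiberKernel {n m k : ℕ} (hm : m ≤ n) (hk : k ≤ n - m) :
    MeasurePreserving Prod.snd (stiefelMeasure n m ⊗ₘ fiberKernel hm hk)
      (stiefelMeasure n k) :=
  (measurePreserving_fst_compProd_fiberKernel (n := n) (m := k) (k := m) (by omega)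
    (by omega)).comp (measurePreserving_swap_compProd_fiberKernel _ _ hm hk)

theorem ae_integrable_fiberMeasure {n m k : ℕ} (hm : m ≤ n) (hk : k ≤ n - m)
    {φ : Stiefel n k → ℂ}
    (hφ : Integrable φ (stiefelMeasure n k)) :
    (∀ᵐ v ∂(stiefelMeasure n m), Integrable φ (fiberMeasure k v)) ∧
      Integrable (fun v : Stiefel n m => ∫ u, φ u ∂(fiberMeasure k v)) (stiefelMeasure n m) := by
  have := isProbabilityMeasure_stiefelMeasure hm
  have h := (measurePreserving_snd_compProd_fiberKernel hm hk).integrable_comp_of_integrable hφ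
  exact ⟨((Measure.integrable_compProd_iff h.1).1 h).1, integrable_integral_compProd h⟩

theorem integrable_mul_cosKernel_prod {n m k : ℕ} (hmk : m ≤ k) (hkn : k + m ≤ n)
    {s : ℂ} (hs : ∀ j < m, 0 < (((k : ℂ) - j) / 2 + s).re) {f : Stiefel n m → ℂ}
    (hf : Integrable f (stiefelMeasure n m)) :
    Integrable (fun p : Stiefel n k × Stiefel n m => f p.2 * cosKernel s p.2 p.1)
      ((stiefelMeasure n k).prod (stiefelMeasure n m)) := by
  have := isProbabilityMeasure_stiefelMeasure (by omega : k ≤ n)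
  have := isProbabilityMeasure_stiefelMeasure (by omega : m ≤ n)
  obtain ⟨C, -, hC, -⟩ := exists_integral_norm_cosKernel_eq (n := n) (by omega) hmk hs
  have hmeas : AEStronglyMeasurable
      (fun p : Stiefel n k × Stiefel n m => f p.2 * cosKernel s p.2 p.1)
      ((stiefelMeasure n k).prod (stiefelMeasure n m)) :=
    (hf.1.comp_quasiMeasurePreserving measurePreserving_snd.quasiMeasurePreserving).mul
      ((measurable_cosKernel s).comp measurable_swap).aestronglyMeasurable
  rw [integrable_prod_iff' hmeas]
  refine ⟨Filter.Eventually.of_forall fun w => (hC w).1.const_mul (f w), ?_⟩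
  simp_rw [norm_mul, integral_const_mul, (hC _).2]
  exact hf.norm.mul_const _

/-- Integrating in v first, the L¹ norm of the kernel does not depend on u, so integrability of f
suffices on the product; slicing gives almost every v. -/
theorem ae_integrable_mul_cosKernel_compProd {n m k : ℕ} (hmk : m ≤ k) (hkn : k + m ≤ n)
    {s : ℂ} (hs : ∀ j < m, 0 < (((k : ℂ) - j) / 2 + s).re) {f : Stiefel n m → ℂ}
    (hf : Integrable f (stiefelMeasure n m)) :
    ∀ᵐ v ∂(stiefelMeasure n m), Integrable
      (fun p : Stiefel n m × Stiefel n k => f p.1 * cosKernel s v p.2)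
      (stiefelMeasure n m ⊗ₘ fiberKernel (by omega : m ≤ n) (by omega : k ≤ n - m)) := by
  have hm : m ≤ n := by omega
  have hk' : k ≤ n - m := by omega
  have := isProbabilityMeasure_stiefelMeasure hm
  obtain ⟨-, C, -, hC⟩ := exists_integral_norm_cosKernel_eq (n := n) (by omega) hmk hs
  let J := stiefelMeasure n m ⊗ₘ fiberKernel hm hk'
  have hfst := measurePreserving_fst_compProd_fiberKernel hm hk'
  have hmeas : AEStronglyMeasurable
      (fun p : Stiefel n m × (Stiefel n m × Stiefel n k) => f p.2.1 * cosKernel s p.1 p.2.2)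
      ((stiefelMeasure n m).prod J) :=
    (hf.1.comp_quasiMeasurePreserving
      (hfst.comp measurePreserving_snd).quasiMeasurePreserving).mul
      ((measurable_cosKernel s).comp
        (measurable_fst.prodMk (measurable_snd.comp measurable_snd))).aestronglyMeasurable
  refine Integrable.prod_right_ae ((integrable_prod_iff' hmeas).2
    ⟨Filter.Eventually.of_forall fun p => (hC p.2).1.const_mul (f p.1), ?_⟩)
  simp_rw [norm_mul, integral_const_mul, (hC _).2]
  exact (hfst.integrable_comp_of_integrable hf.norm).mul_const _

/-- The dual cosine transform of the Funk transform is a multiple of the sine transform. -/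
theorem ae_integral_funk_mul_cosKernel {n m k : ℕ} (hmk : m ≤ k) (hkn : k + m ≤ n)
    {s : ℂ} (hs : ∀ j < m, 0 < (((k : ℂ) - j) / 2 + s).re) {f : Stiefel n m → ℂ}
    (hf : Integrable f (stiefelMeasure n m)) :
    ∀ᵐ v ∂(stiefelMeasure n m),
      Integrable (fun u : Stiefel n k => funk f u * cosKernel s v u) (stiefelMeasure n k) ∧
      Integrable (fun w => f w * sinKernel s w v) (stiefelMeasure n m) ∧
      ∫ u : Stiefel n k, funk f u * cosKernel s v u ∂(stiefelMeasure n k) =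
        cosConst s (n - m : ℕ) k m * ∫ w, f w * sinKernel s w v ∂(stiefelMeasure n m) := by
  have hm : m ≤ n := by omega
  have hk : k ≤ n := by omega
  have hk' : k ≤ n - m := by omega
  have hm' : m ≤ n - k := by omega
  have := isProbabilityMeasure_stiefelMeasure hm
  have := isProbabilityMeasure_stiefelMeasure hk
  have hc0 := cosConst_ne_zero hk' hmk hs
  filter_upwards [ae_integrable_mul_cosKernel_compProd hmk hkn hs hf] with v hv
  -- The law of orthogonal pairs is disintegrated in two ways: over w the inner integral gives the
  -- sine kernel, over u (`h3` below) it gives F f times the cosine kernel.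
  have hfib : ∀ w : Stiefel n m, ∫ u : Stiefel n k, f w * cosKernel s v u ∂(fiberMeasure k w) =
      cosConst s (n - m : ℕ) k m * (f w * sinKernel s w v) := by
    intro w
    rw [integral_const_mul, (integral_cosKernel_fiberMeasure hm hk' hmk hs v w).2,
      sinKernel_comm s v w]
    ring
  have h1 : Integrable (fun w => cosConst s (n - m : ℕ) k m * (f w * sinKernel s w v))
      (stiefelMeasure n m) := by
    simp_rw [← hfib]
    exact integrable_integral_compProd hv
  have hswap := measurePreserving_swap_compProd_fiberKernel hm hk' hk hm'
  have h2 : Integrable (fun p : Stiefel n k × Stiefel n m => f p.2 * cosKernel s v p.1)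
      (stiefelMeasure n k ⊗ₘ fiberKernel hk hm') :=
    hswap.integrable_comp_of_integrable hv
  have h3 : ∀ u : Stiefel n k, ∫ w, f w * cosKernel s v u ∂(fiberKernel hk hm' u) =
      funk f u * cosKernel s v u := fun u => integral_mul_const _ _
  refine ⟨?_, ?_, ?_⟩
  · simp_rw [← h3]
    exact integrable_integral_compProd h2
  · exact (h1.const_mul (cosConst s (n - m : ℕ) k m)⁻¹).congr
      (Filter.Eventually.of_forall fun w => inv_mul_cancel_left₀ hc0 _)
  · simp_rw [← h3]
    rw [← integral_const_mul, ← Measure.integral_compProd h2]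
    simp_rw [← hfib]
    refine Eq.trans ?_ (Measure.integral_compProd hv)
    rw [← hswap.map_eq, integral_map measurable_swap.aemeasurable
      (by rw [hswap.map_eq]; exact hv.1)]
    rfl

/-- The dual Funk transform of the cosine transform is a multiple of the sine transform. -/
theorem ae_integral_fiberMeasure_cosKernel {n m k : ℕ} (hmk : m ≤ k) (hkn : k + m ≤ n)
    {s : ℂ} (hs : ∀ j < m, 0 < (((k : ℂ) - j) / 2 + s).re) {f : Stiefel n m → ℂ}
    (hf : Integrable f (stiefelMeasure n m)) :
    ∀ᵐ v ∂(stiefelMeasure n m),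
      Integrable (fun u : Stiefel n k => ∫ w, f w * cosKernel s w u ∂(stiefelMeasure n m))
        (fiberMeasure k v) ∧
      ∫ u : Stiefel n k, ∫ w, f w * cosKernel s w u ∂(stiefelMeasure n m) ∂(fiberMeasure k v) =
        cosConst s (n - m : ℕ) k m * ∫ w, f w * sinKernel s w v ∂(stiefelMeasure n m) := by
  have hm : m ≤ n := by omega
  have hk : k ≤ n := by omega
  have hk' : k ≤ n - m := by omega
  have := isProbabilityMeasure_stiefelMeasure hm
  have := isProbabilityMeasure_stiefelMeasure hk
  have hsnd := measurePreserving_snd_compProd_fiberKernel hm hk'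
  have hprod := integrable_mul_cosKernel_prod hmk hkn hs hf
  -- Applied to u ↦ ∫ |f(w)| |cosine kernel| dw, which is in L¹(V_{n,k}) and so integrable over
  -- almost every fiber; this gives the absolute convergence needed to interchange integrals.
  have h1 := (ae_integrable_fiberMeasure hm hk' hprod.integral_norm_prod_left.ofReal).1
  have h2 := Measure.ae_ae_of_ae_compProd
    (hsnd.quasiMeasurePreserving.ae hprod.prod_right_ae)
  filter_upwards [h1, h2] with v h1v h2v
  have := isProbabilityMeasure_fiberMeasure hk' v
  have hmeas : AEStronglyMeasurable
      (fun p : Stiefel n k × Stiefel n m => f p.2 * cosKernel s p.2 p.1)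
      ((fiberMeasure k v).prod (stiefelMeasure n m)) :=
    (hf.1.comp_quasiMeasurePreserving measurePreserving_snd.quasiMeasurePreserving).mul
      ((measurable_cosKernel s).comp measurable_swap).aestronglyMeasurable
  have hI : Integrable (fun p : Stiefel n k × Stiefel n m => f p.2 * cosKernel s p.2 p.1)
      ((fiberMeasure k v).prod (stiefelMeasure n m)) :=
    (integrable_prod_iff hmeas).2 ⟨h2v, by simpa using h1v.re⟩
  refine ⟨hI.integral_prod_left, ?_⟩
  rw [integral_integral_swap (f := fun (u : Stiefel n k) w => f w * cosKernel s w u) hI,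
    ← integral_const_mul]
  refine integral_congr_ae (Filter.Eventually.of_forall fun w => ?_)
  simp only
  rw [integral_const_mul, (integral_cosKernel_fiberMeasure hm hk' hmk hs w v).2]
  ring

/-! ### Constants in terms of Siegel gamma functions. -/

theorem siegelGamma_mul_div_mul (m : ℕ) (a b c d : ℂ) :
    siegelGamma m a * siegelGamma m b / (siegelGamma m c * siegelGamma m d) =
      ∏ j ∈ Finset.range m, Complex.Gamma (a - j / 2) * Complex.Gamma (b - j / 2) /
        (Complex.Gamma (c - j / 2) * Complex.Gamma (d - j / 2)) := by
  have h : ((Real.pi ^ ((m : ℝ) * ((m : ℝ) - 1) / 4) : ℝ) : ℂ) ≠ 0 := by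
    exact_mod_cast (Real.rpow_pos_of_pos Real.pi_pos _).ne'
  rw [Finset.prod_div_distrib, Finset.prod_mul_distrib, Finset.prod_mul_distrib]
  simp only [siegelGamma]
  rw [mul_mul_mul_comm, mul_mul_mul_comm _ _ _ (∏ j ∈ Finset.range m,
    Complex.Gamma (d - j / 2)), mul_div_mul_left _ _ (mul_ne_zero h h)]

/-- For s = (α - k)/2 the shifted arguments (k - j)/2 + s and (n - j)/2 + s become α/2 - j/2 and (α
+ n - k)/2 - j/2. The identity is formal, so it also applies with n replaced by m, where k may
exceed it. -/
theorem cosConst_eq_siegelGamma (α : ℂ) (n k m : ℕ) :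
    cosConst ((α - k) / 2) n k m =
      siegelGamma m ((n : ℂ) / 2) * siegelGamma m (α / 2) /
        (siegelGamma m ((k : ℂ) / 2) * siegelGamma m ((α + n - k) / 2)) := by
  rw [siegelGamma_mul_div_mul, cosConst]
  refine Finset.prod_congr rfl fun j _ => ?_
  simp only [gaussMoment]
  rw [div_div_div_eq]
  congr 1
  · rw [mul_comm]
    congr 2 <;> ring
  · congr 2 <;> ring

/-- Telescoping through the moments in dimensions m - j. The factor `cosConst s m k m` is a formal
constant, not the value of an integral when k > m. -/
theorem cosConst_eq_mul {s : ℂ} {n k m : ℕ} (hm : m ≤ n)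
    (hs : ∀ j < m, 0 < (((m : ℂ) - j) / 2 + s).re) :
    cosConst s n k m = cosConst s m k m * cosConst s n m m := by
  have h := cosConst_ne_zero hm le_rfl hs
  rw [cosConst, cosConst, cosConst, ← Finset.prod_mul_distrib]
  refine Finset.prod_congr rfl fun j hj => ?_
  have := div_ne_zero_iff.1 (Finset.prod_ne_zero_iff.1 h j hj)
  rw [div_mul_div_cancel₀ this.1]

end StiefelTransforms

/-! ### Assembly of the two parts. -/

theorem mainTheorem11 (n m k : ℕ) (hm : 1 ≤ m) (hmk : m ≤ k) (hkn : k + m ≤ n)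
    (f : StiefelTransforms.Stiefel n m → ℂ)
    (hf : MeasureTheory.Integrable f (StiefelTransforms.stiefelMeasure n m)) (α : ℂ) :
    -- first part: `Re α > m - 1`
    ((m : ℝ) - 1 < α.re →
      -- `F_{m,k} f` converges absolutely a.e. and is integrable
      (∀ᵐ u ∂(StiefelTransforms.stiefelMeasure n k),
        MeasureTheory.Integrable f (StiefelTransforms.fiberMeasure m u)) ∧
      MeasureTheory.Integrable
        (fun u : StiefelTransforms.Stiefel n k => StiefelTransforms.funk f u)
        (StiefelTransforms.stiefelMeasure n k) ∧
      -- `C^α_{m,k} f` converges absolutely a.e. and is integrable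
      (∀ᵐ u ∂(StiefelTransforms.stiefelMeasure n k),
        MeasureTheory.Integrable
          (fun v => f v * StiefelTransforms.cosKernel ((α - k) / 2) v u)
          (StiefelTransforms.stiefelMeasure n m)) ∧
      MeasureTheory.Integrable
        (fun u : StiefelTransforms.Stiefel n k => StiefelTransforms.cosineTransform α f u)
        (StiefelTransforms.stiefelMeasure n k) ∧
      -- for a.e. `v` the three outer integrals converge absolutely and the equalities hold
      (∀ᵐ v ∂(StiefelTransforms.stiefelMeasure n m),
        MeasureTheory.Integrable
          (fun u : StiefelTransforms.Stiefel n k =>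
            StiefelTransforms.funk f u * StiefelTransforms.cosKernel ((α - k) / 2) v u)
          (StiefelTransforms.stiefelMeasure n k) ∧
        MeasureTheory.Integrable
          (fun u : StiefelTransforms.Stiefel n k => StiefelTransforms.cosineTransform α f u)
          (StiefelTransforms.fiberMeasure k v) ∧
        MeasureTheory.Integrable
          (fun w => f w * StiefelTransforms.sinKernel (((α + n - k - m) + m - n) / 2) w v)
          (StiefelTransforms.stiefelMeasure n m) ∧
        StiefelTransforms.dualCosineTransform (k := k) α (StiefelTransforms.funk f) v =
          StiefelTransforms.dualFunk (k := k) (StiefelTransforms.cosineTransform α f) v ∧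
        StiefelTransforms.dualFunk (k := k) (StiefelTransforms.cosineTransform α f) v =
          (StiefelTransforms.siegelGamma m (((n : ℂ) - m) / 2) *
              StiefelTransforms.siegelGamma m (α / 2) /
            (StiefelTransforms.siegelGamma m ((k : ℂ) / 2) *
              StiefelTransforms.siegelGamma m ((α + n - m - k) / 2))) *
            StiefelTransforms.sineQ (α + n - k - m) f v)) ∧
    -- second part: `Re α > k - 1`
    ((k : ℝ) - 1 < α.re →
      -- `F_m f` converges absolutely a.e. and is integrable
      (∀ᵐ u ∂(StiefelTransforms.stiefelMeasure n m),
        MeasureTheory.Integrable f (StiefelTransforms.fiberMeasure m u)) ∧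
      MeasureTheory.Integrable
        (fun u : StiefelTransforms.Stiefel n m => StiefelTransforms.funk f u)
        (StiefelTransforms.stiefelMeasure n m) ∧
      (∀ᵐ v ∂(StiefelTransforms.stiefelMeasure n m),
        MeasureTheory.Integrable
          (fun w : StiefelTransforms.Stiefel n m =>
            StiefelTransforms.funk f w *
              StiefelTransforms.cosKernel (((α + m - k) - m) / 2) w v)
          (StiefelTransforms.stiefelMeasure n m) ∧
        StiefelTransforms.dualCosineTransform (k := k) α (StiefelTransforms.funk f) v =
          StiefelTransforms.dualFunk (k := k) (StiefelTransforms.cosineTransform α f) v ∧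
        StiefelTransforms.dualFunk (k := k) (StiefelTransforms.cosineTransform α f) v =
          (StiefelTransforms.siegelGamma m ((m : ℂ) / 2) *
              StiefelTransforms.siegelGamma m (α / 2) /
            (StiefelTransforms.siegelGamma m ((k : ℂ) / 2) *
              StiefelTransforms.siegelGamma m ((α + m - k) / 2))) *
            StiefelTransforms.cosineM (α + m - k) (StiefelTransforms.funk f) v)) := by
  have hmn : m ≤ n := by omega
  have hk : k ≤ n := by omega
  have hm' : m ≤ n - k := by omega
  -- The shifts of the parameter in Q and M are such that all kernels carry the same exponent (α -
  -- k)/2.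
  have hexp : ((α + n - k - m) + m - n) / 2 = (α - k) / 2 := by ring
  have hexp' : ((α + m - k) - m) / 2 = (α - k) / 2 := by ring
  have hre : ∀ l j : ℕ, (((l : ℂ) - j) / 2 + (α - k) / 2).re =
      (α.re + ((l : ℝ) - k) - j) / 2 := by
    intro l j
    simp only [Complex.add_re, Complex.div_ofNat_re, Complex.sub_re, Complex.natCast_re]
    ring
  have hmain : ∀ j < m, (m : ℝ) - 1 < α.re → 0 < (((k : ℂ) - j) / 2 + (α - k) / 2).re := by
    intro j hj h
    rw [hre]
    have : (j : ℝ) + 1 ≤ m := by exact_mod_cast hj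
    linarith
  have hconst : StiefelTransforms.cosConst ((α - k) / 2) (n - m : ℕ) k m =
      StiefelTransforms.siegelGamma m (((n : ℂ) - m) / 2) *
        StiefelTransforms.siegelGamma m (α / 2) /
        (StiefelTransforms.siegelGamma m ((k : ℂ) / 2) *
          StiefelTransforms.siegelGamma m ((α + n - m - k) / 2)) := by
    rw [StiefelTransforms.cosConst_eq_siegelGamma, Nat.cast_sub hmn,
      show α + ((n : ℂ) - m) - k = α + n - m - k by ring]
  refine ⟨fun hα => ?_, fun hα => ?_⟩
  · have hs : ∀ j < m, 0 < (((k : ℂ) - j) / 2 + (α - k) / 2).re := fun j hj => hmain j hj hα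
    have hF := StiefelTransforms.ae_integrable_fiberMeasure hk hm' hf
    have hC := StiefelTransforms.integrable_mul_cosKernel_prod hmk hkn hs hf
    have := StiefelTransforms.isProbabilityMeasure_stiefelMeasure hmn
    have := StiefelTransforms.isProbabilityMeasure_stiefelMeasure hk
    refine ⟨hF.1, hF.2, hC.prod_right_ae, hC.integral_prod_left, ?_⟩
    filter_upwards [StiefelTransforms.ae_integral_funk_mul_cosKernel hmk hkn hs hf,
      StiefelTransforms.ae_integral_fiberMeasure_cosKernel hmk hkn hs hf] with v h1 h2
    simp only [StiefelTransforms.sineQ, hexp, ← hconst]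
    exact ⟨h1.1, h2.1, h1.2.1, h1.2.2.trans h2.2.symm, h2.2⟩
  · have hmk' : (m : ℝ) ≤ k := by exact_mod_cast hmk
    have hs : ∀ j < m, 0 < (((k : ℂ) - j) / 2 + (α - k) / 2).re :=
      fun j hj => hmain j hj (by linarith)
    -- The convergence condition with m in place of k but the same exponent; its worst case j = m -
    -- 1 is Re α > k - 1.
    have hs' : ∀ j < m, 0 < (((m : ℂ) - j) / 2 + (α - k) / 2).re := by
      intro j hj
      rw [hre]
      have : (j : ℝ) + 1 ≤ m := by exact_mod_cast hj
      linarith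
    have hF := StiefelTransforms.ae_integrable_fiberMeasure hmn (by omega : m ≤ n - m) hf
    refine ⟨hF.1, hF.2, ?_⟩
    -- The third fact is the case k = m: it turns the sine integral into the cosine transform of F_m
    -- f.
    filter_upwards [StiefelTransforms.ae_integral_funk_mul_cosKernel hmk hkn hs hf,
      StiefelTransforms.ae_integral_fiberMeasure_cosKernel hmk hkn hs hf,
      StiefelTransforms.ae_integral_funk_mul_cosKernel le_rfl (by omega) hs' hf] with v h1 h2 h3
    simp only [StiefelTransforms.cosineM, hexp', ← StiefelTransforms.cosConst_eq_siegelGamma,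
      StiefelTransforms.cosKernel_comm _ _ v]
    refine ⟨h3.1, h1.2.2.trans h2.2.symm, h2.2.trans ?_⟩
    rw [StiefelTransforms.cosConst_eq_mul (by omega) hs', mul_assoc, ← h3.2.2]
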